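/- Let $R$ be a finite commutative chain ring with maximal ideal $\langle\pi\rangle$, residue field of size $q$ and nilpotency index $s$ of $\pi$ (the least $s\ge 1$ with $\pi^s=0$), and let $\mathcal R\ni 0$ be a complete set of residues modulo $\pi$; put $\mathcal R(\pi^l)=\{\sum_{i<l}a_i\pi^i: a_i\in\mathcal R\}$. Let $\deg a$ be the largest $l\le s$ with $\pi^l\mid a$. An $s$-shape is a sequence of integers $0\le\mu_1\le\dots\le\mu_s$; put $|\mu|=\sum_i\mu_i$, $\mu_0=0$, and $R^\mu=\langle1\rangle^{\mu_1}\times\langle\pi\rangle^{\mu_2-\mu_1}\times\dots\times\langle\pi^{s-1}\rangle^{\mu_s-\mu_{s-1}}$. A matrix has shape $\kappa$ if its row span is isomorphic to $R^\kappa$; an $N\times n$ matrix has full column rank if its transpose has shape $(n,\dots,n)$. $R^{n\times\mu}$ is the set of $n\times\mu_s$ matrices whose rows lie in $R^\mu$. The pivot of a nonzero row is the first of its entries of least degree. A matrix is in row canonical form if (1) nonzero rows are above zero rows; (2) pivots of smaller degree are above pivots of larger degree, and among pivots of equal degree the earlier one (by column) is above the later one; (3) every pivot is $\pi^l$ for some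 $0\le l<s$; (4) the entries below a pivot $\pi^l$ in its column are $0$ and those above it lie in $\mathcal R(\pi^l)$. A row canonical form of $Y$ is a matrix in row canonical form of the form $UY$ with $U$ invertible. A matrix in $R^{n\times\mu}$ that has shape $\kappa$ and is in row canonical form is principal if its diagonal is $1$ ($\kappa_1$ times), $\pi$ ($\kappa_2-\kappa_1$ times), …, $\pi^{s-1}$ ($\kappa_s-\kappa_{s-1}$ times), then $0$. For $N\ge n$, the multiplicative matrix channel (MMC) is $Y=AX$, with $X\in R^{n\times\mu}$ and $A$ uniform over the $N\times n$ matrices of full column rank, independent of $X$; its capacity is $C_{\rm MMC}=\max_{p_X}I(X;Y)$, with logarithms to the base $q$. Let $\kappa_i=\min\{n,\lfloor\mu_i/2\rfloor\}$. In the MMC coding scheme the codebook is the set of principal row canonical forms of shape $\kappa$ in $R^{n\times\mu}$. A message consists of $\sum_i\kappa_i(\mu_i-\kappa_i)$ symbols from $\mathcal R$ (so $q$-ary symbols) and is encoded as $X=\sum_{i=0}^{s-1}\pi^iX_i$, where $X_i$ has message symbols in rows $1,\dots,\kappa_{i+1}$ and columns $\kappa_{i+1}+1,\dots,\mu_{i+1}$,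 ones at the diagonal positions $\kappa_i+1,\dots,\kappa_{i+1}$ (with $\kappa_0=0$), and zeros elsewhere. The decoder outputs the first $n$ rows of the row canonical form of $Y$. **Theorem.** (a) For all $n\le N$ and all $s$-shapes $\mu$, the encoder is a bijection from messages onto the codebook, and the rate ($\log_q$ of the codebook size) is $\sum_{i=1}^s\kappa_i(\mu_i-\kappa_i)$. For every codeword $X$ and every $A$ of full column rank, the unique row canonical form of $AX$ is $X$ followed by $N-n$ zero rows, so the decoder outputs $X$; that is, the error probability is $0$ for every codeword. (b) Let $m=\mu_s\to\infty$ (along any sequence of parameters $n\le N$, $\mu$) with $\bar n=n/m>0$ and $\bar\mu=\mu/m$ fixed. Then $\kappa_i/m\to\bar\kappa_i:=\min\{\bar n,\bar\mu_i/2\}$, and the asymptotic capacity is $$\bar C_{\rm MMC}=\lim\frac{C_{\rm MMC}}{n|\mu|}=\frac{\sum_{i=1}^s\bar\kappa_i(\bar\mu_i-\bar\kappa_i)}{\bar n\,|\bar\mu|}.$$ The scheme achieves it: its normalized rate $\frac1{n|\mu|}\sum_{i=1}^s\kappa_i(\mu_i-\kappa_i)$ converges to the same limit. -/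

import Mathlib

open Filter Topology

noncomputable section

namespace MMC

/-! ### Discrete memoryless channels -/

section Channel

variable {𝒳 𝒴 : Type*} [Fintype 𝒳] [Fintype 𝒴]

/-- Mutual information `I(X;Y)`, with logarithms to the base `q`, for input distribution `p` and
channel transition probabilities `W x y = p(y | x)`. Terms of probability zero contribute `0`. -/
def mutualInfo (q : ℕ) (W : 𝒳 → 𝒴 → ℝ) (p : 𝒳 → ℝ) : ℝ :=
  ∑ x, ∑ y, p x * W x y * Real.logb q (W x y / ∑ x', p x' * W x' y)

/-- Capacity `C = max_{p_X} I(X;Y)` in `q`-ary units per channel use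
(the maximum exists, see `capacity_isGreatest`). -/
def capacity (q : ℕ) (W : 𝒳 → 𝒴 → ℝ) : ℝ :=
  sSup (mutualInfo q W '' stdSimplex ℝ 𝒳)

theorem mutualInfo_eq (q : ℕ) (W : 𝒳 → 𝒴 → ℝ) (hW : ∀ x y, 0 ≤ W x y) (p : 𝒳 → ℝ)
    (hp : p ∈ stdSimplex ℝ 𝒳) :
    mutualInfo q W p = (∑ x, ∑ y, p x * W x y * Real.logb q (W x y)) +
      ∑ y, Real.negMulLog (∑ x', p x' * W x' y) / Real.log q := by
  have key : ∀ x y, p x * W x y * Real.logb q (W x y / ∑ x', p x' * W x' y) =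
      p x * W x y * Real.logb q (W x y)
        - p x * W x y * Real.logb q (∑ x', p x' * W x' y) := by
    intro x y
    rcases eq_or_ne (p x * W x y) 0 with h0 | h0
    · simp [h0]
    · have hW0 : W x y ≠ 0 := fun h => h0 (by simp [h])
      have hpos : 0 < p x * W x y :=
        lt_of_le_of_ne (mul_nonneg (hp.1 x) (hW x y)) (Ne.symm h0)
      have hle : p x * W x y ≤ ∑ x', p x' * W x' y :=
        Finset.single_le_sum (f := fun x' => p x' * W x' y)
          (fun x' _ => mul_nonneg (hp.1 x') (hW x' y)) (Finset.mem_univ x)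
      rw [Real.logb_div hW0 (by linarith), mul_sub]
  unfold mutualInfo
  simp_rw [key, Finset.sum_sub_distrib]
  rw [sub_eq_add_neg]
  congr 1
  rw [Finset.sum_comm, ← Finset.sum_neg_distrib]
  refine Finset.sum_congr rfl fun y _ => ?_
  rw [← Finset.sum_mul]
  simp only [Real.negMulLog, Real.logb]
  ring

theorem capacity_isGreatest [Nonempty 𝒳] (q : ℕ) (W : 𝒳 → 𝒴 → ℝ) (hW : ∀ x y, 0 ≤ W x y) :
    IsGreatest (mutualInfo q W '' stdSimplex ℝ 𝒳) (capacity q W) := by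
  classical
  have hcont : ContinuousOn (mutualInfo q W) (stdSimplex ℝ 𝒳) := by
    refine ContinuousOn.congr (Continuous.continuousOn ?_) (fun p hp => mutualInfo_eq q W hW p hp)
    refine Continuous.add (by fun_prop) ?_
    refine continuous_finsetSum _ fun y _ => Continuous.div_const ?_ _
    exact Real.continuous_negMulLog.comp (by fun_prop)
  have hK : IsCompact (mutualInfo q W '' stdSimplex ℝ 𝒳) :=
    (isCompact_stdSimplex ℝ 𝒳).image_of_continuousOn hcont
  have hne : (mutualInfo q W '' stdSimplex ℝ 𝒳).Nonempty :=
    ⟨_, _, single_mem_stdSimplex ℝ (Classical.arbitrary 𝒳), rfl⟩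
  exact hK.isGreatest_sSup hne

end Channel

/-! ### Finite chain rings -/

/-- The finite commutative ring `R` is a `(q, s)` chain ring with maximal ideal `⟨π⟩`: `1 ≠ 0`, its
ideals form a chain, its residue field has `q` elements, and `s` is the nilpotency index of `π`. -/
structure IsFiniteChainRing (R : Type*) [CommRing R] [Finite R] (π : R) (q s : ℕ) : Prop where
  nontrivial : Nontrivial R
  chain : ∀ I J : Ideal R, I ≤ J ∨ J ≤ I
  maximal : (Ideal.span {π}).IsMaximal
  card_residue : Nat.card (R ⧸ Ideal.span {π}) = q
  nilpotency : IsLeast {k : ℕ | 0 < k ∧ π ^ k = 0} s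

variable {R : Type*} [CommRing R]

/-- `Res` is a complete set of residues with respect to `π`, containing `0`. -/
structure IsResidueSet (π : R) (Res : Set R) : Prop where
  zero_mem : (0 : R) ∈ Res
  existsUnique : ∀ a : R, ∃! r : R, r ∈ Res ∧ a - r ∈ Ideal.span {π}

/-- The set `ℛ(R, π^l)` of all `∑_{i<l} a_i π^i` with digits `a_i` in `Res`. -/
def residuesPow (π : R) (Res : Set R) (l : ℕ) : Set R :=
  {x | ∃ a : ℕ → R, (∀ i, a i ∈ Res) ∧ x = ∑ i ∈ Finset.range l, a i * π ^ i}

open Classical in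
/-- The degree of `a`: the largest `l ≤ s` such that `π ^ l` divides `a`, which is the least index
of a nonzero `π`-adic digit if `a ≠ 0`, and `s` if `a = 0`. -/
def deg (π : R) (s : ℕ) (a : R) : ℕ := Nat.findGreatest (fun l => π ^ l ∣ a) s

/-! ### Shapes and modules. An `s`-shape is a monotone `μ : Fin s → ℕ` (indexed from `0`). -/

/-- The packet length `m` attached to a shape; by monotonicity, this is the last component. -/
def len {s : ℕ} (μ : Fin s → ℕ) : ℕ := Finset.univ.sup μ

/-- The number of components of `μ` that are `≤ j`. For an index `j` (counted from `0`) this is `0`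
on the first `μ_1` indices, `1` on the next `μ_2 - μ_1`, ..., and `s` for `j ≥ μ_s`. -/
def shapeExp {s : ℕ} (μ : Fin s → ℕ) (j : ℕ) : ℕ := (Finset.univ.filter fun i => μ i ≤ j).card

/-- The module `R^μ = ⟨1⟩^{μ_1} × ⟨π⟩^{μ_2 - μ_1} × ⋯ × ⟨π^{s-1}⟩^{μ_s - μ_{s-1}}`. -/
def shapeModule (π : R) {s : ℕ} (μ : Fin s → ℕ) : Submodule R (Fin (len μ) → R) where
  carrier := {x | ∀ j : Fin (len μ), x j ∈ Ideal.span {π ^ shapeExp μ j}}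
  zero_mem' := fun _ => Ideal.zero_mem _
  add_mem' := fun hx hy j => Ideal.add_mem _ (hx j) (hy j)
  smul_mem' := fun c _ hx j => Ideal.mul_mem_left _ c (hx j)

/-- The row span of a matrix. -/
def rowSpan {n m : ℕ} (A : Matrix (Fin n) (Fin m) R) : Submodule R (Fin m → R) :=
  Submodule.span R (Set.range fun i => A i)

/-- The shape of the matrix `A`, i.e. of its row span, is `κ`. -/
def HasShape (π : R) {s n m : ℕ} (A : Matrix (Fin n) (Fin m) R) (κ : Fin s → ℕ) : Prop :=
  Nonempty (rowSpan A ≃ₗ[R] shapeModule π κ)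

/-- `A` has full column rank: its transpose, an `n × N` matrix, has shape `(n, …, n)`. -/
def IsFullColRank (π : R) (s : ℕ) {N n : ℕ} (A : Matrix (Fin N) (Fin n) R) : Prop :=
  HasShape π A.transpose (fun _ : Fin s => n)

/-- The set `R^{n × μ}` of the `n`-row matrices whose rows lie in `R^μ`. -/
def MatSet (π : R) (n : ℕ) {s : ℕ} (μ : Fin s → ℕ) : Set (Matrix (Fin n) (Fin (len μ)) R) :=
  {X | ∀ i, X i ∈ shapeModule π μ}

instance [Finite R] (π : R) (n : ℕ) {s : ℕ} (μ : Fin s → ℕ) : Fintype (MatSet π n μ) :=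
  haveI : Finite (Matrix (Fin n) (Fin (len μ)) R) := inferInstanceAs (Finite (_ → _ → _))
  Fintype.ofFinite _

/-! ### Row canonical forms -/

/-- The `(i, c)` entry is the pivot of row `i`: the row is nonzero and this is the first among the
entries of least degree. -/
def IsPivot (π : R) (s : ℕ) {n m : ℕ} (A : Matrix (Fin n) (Fin m) R) (i : Fin n) (c : Fin m) :
    Prop :=
  A i ≠ 0 ∧ (∀ j, deg π s (A i c) ≤ deg π s (A i j)) ∧
    ∀ j, j < c → deg π s (A i c) < deg π s (A i j)

/-- `A` is in row canonical form. -/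
structure IsRowCanonical (π : R) (s : ℕ) (Res : Set R) {n m : ℕ} (A : Matrix (Fin n) (Fin m) R) :
    Prop where
  zero_below : ∀ i i', A i ≠ 0 → A i' = 0 → i < i'
  order_same : ∀ i i' c c', IsPivot π s A i c → IsPivot π s A i' c' →
    deg π s (A i c) = deg π s (A i' c') → c < c' → i < i'
  order_diff : ∀ i i' c c', IsPivot π s A i c → IsPivot π s A i' c' →
    deg π s (A i c) < deg π s (A i' c') → i < i'
  pivot_form : ∀ i c, IsPivot π s A i c → ∃ l < s, A i c = π ^ l
  below_pivot : ∀ i c, IsPivot π s A i c → ∀ i', i < i' → A i' c = 0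
  above_pivot : ∀ i c, IsPivot π s A i c → ∀ l < s, A i c = π ^ l →
    ∀ i', i' < i → A i' c ∈ residuesPow π Res l

/-- `B` is a row canonical form of `A`: it is in row canonical form and left-equivalent to `A`. -/
def IsRCFOf (π : R) (s : ℕ) (Res : Set R) {n m : ℕ} (B A : Matrix (Fin n) (Fin m) R) : Prop :=
  IsRowCanonical π s Res B ∧ ∃ U : (Matrix (Fin n) (Fin n) R)ˣ, (U : Matrix _ _ R) * A = B

/-- The row canonical form `RCF(A)` of `A`. -/
def rcf (π : R) (s : ℕ) (Res : Set R) {n m : ℕ} (A : Matrix (Fin n) (Fin m) R) :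
    Matrix (Fin n) (Fin m) R :=
  Classical.epsilon fun B => IsRCFOf π s Res B A

/-- The principal row canonical forms for `𝒯_κ(R^{n × μ})`: matrices in `R^{n × μ}` of shape `κ`
that are in row canonical form and have diagonal `1, …, 1` (`κ_1` times), `π, …, π` (`κ_2 - κ_1`
times), ..., `π^{s-1}, …, π^{s-1}` (`κ_s - κ_{s-1}` times), `0, …, 0` (as `π^s = 0`). -/
def principalForms (π : R) (Res : Set R) (n : ℕ) {s : ℕ} (μ κ : Fin s → ℕ) :
    Set (Matrix (Fin n) (Fin (len μ)) R) :=
  {X | X ∈ MatSet π n μ ∧ HasShape π X κ ∧ IsRowCanonical π s Res X ∧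
    ∀ (i : Fin n) (j : Fin (len μ)), (i : ℕ) = j → X i j = π ^ shapeExp κ i}

/-! ### The multiplicative matrix channel -/

/-- Transition probability `p(Y | X)` of the channel `Y = A X`, where `A` is uniform over the
`N × n` matrices of full column rank and independent of `X`. -/
def mmcProb (π : R) (s : ℕ) {N n m : ℕ} (X : Matrix (Fin n) (Fin m) R)
    (Y : Matrix (Fin N) (Fin m) R) : ℝ :=
  ({A : Matrix (Fin N) (Fin n) R | IsFullColRank π s A ∧ A * X = Y}.ncard : ℝ) /
    ({A : Matrix (Fin N) (Fin n) R | IsFullColRank π s A}.ncard : ℝ)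

/-- The capacity of the channel with inputs in `R^{n × μ}` and outputs in `R^{N × μ}`. -/
def mmcCapacity [Finite R] (π : R) (q N n : ℕ) {s : ℕ} (μ : Fin s → ℕ) : ℝ :=
  capacity q fun (X : MatSet π n μ) (Y : MatSet π N μ) => mmcProb π s X.1 Y.1

/-! ### The coding scheme -/

/-- The shape `κ_i = min {n, ⌊μ_i / 2⌋}`. -/
def kappa (n : ℕ) {s : ℕ} (μ : Fin s → ℕ) : Fin s → ℕ := fun i => min n (μ i / 2)

/-- The positions of the `∑ κ_i (μ_i - κ_i)` message symbols: for each `i`, a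
`κ_i × (μ_i - κ_i)` array. -/
abbrev MsgIdx {s : ℕ} (μ κ : Fin s → ℕ) : Type := (i : Fin s) × (Fin (κ i) × Fin (μ i - κ i))

/-- The auxiliary matrix `X_i` built from the message `u`: row `a < κ_i` has a `1` at the diagonal
positions that are `≥ κ_{i-1}` (with `κ_0 = 0`) and `< κ_i`, symbols of `u` in columns
`κ_i ≤ b < μ_i`, and all other entries are zero. -/
def auxMatrix {Res : Set R} (n : ℕ) {s : ℕ} (μ κ : Fin s → ℕ) (u : MsgIdx μ κ → Res) (i : Fin s) :
    Matrix (Fin n) (Fin (len μ)) R :=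
  fun a b =>
    if ha : (a : ℕ) < κ i then
      if hb : κ i ≤ (b : ℕ) ∧ (b : ℕ) < μ i then
        (u ⟨i, ⟨a, ha⟩, ⟨b - κ i, by omega⟩⟩ : R)
      else if (a : ℕ) = b ∧ ∀ i' < i, κ i' ≤ (a : ℕ) then 1 else 0
    else 0

/-- The encoder: `X = X_0 + π X_1 + ⋯ + π^{s-1} X_{s-1}`. -/
def encode (π : R) {Res : Set R} (n : ℕ) {s : ℕ} (μ κ : Fin s → ℕ) (u : MsgIdx μ κ → Res) :
    Matrix (Fin n) (Fin (len μ)) R :=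
  ∑ i : Fin s, π ^ (i : ℕ) • auxMatrix n μ κ u i

/-- `X` followed by `N - n` zero rows. -/
def padRows {n m : ℕ} (N : ℕ) (X : Matrix (Fin n) (Fin m) R) : Matrix (Fin N) (Fin m) R :=
  fun i j => if h : (i : ℕ) < n then X ⟨i, h⟩ j else 0

/-- The decoder: compute the row canonical form of the received `N`-row matrix `Y` and keep its
first `n` rows. -/
def decode (π : R) (s : ℕ) (Res : Set R) {N n m : ℕ} (h : n ≤ N) (Y : Matrix (Fin N) (Fin m) R) :
    Matrix (Fin n) (Fin m) R :=
  (rcf π s Res Y).submatrix (Fin.castLE h) id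

open Classical in
/-- The probability that the decoder output differs from the transmitted matrix `X`. -/
def errorProb [Finite R] (π : R) (Res : Set R) {N n s : ℕ} (h : n ≤ N) (μ : Fin s → ℕ)
    (X : Matrix (Fin n) (Fin (len μ)) R) : ℝ :=
  ∑ Y : MatSet π N μ, if decode π s Res h Y.1 = X then 0 else mmcProb π s X Y.1

/-- The rate of the scheme, in `q`-ary symbols per channel use: `log_q` of the codebook size. -/
def rate (π : R) (Res : Set R) (q n : ℕ) {s : ℕ} (μ : Fin s → ℕ) : ℝ :=
  Real.logb q ((principalForms π Res n μ (kappa n μ)).ncard : ℝ)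

end MMC

end

/-! Part (a) rests on uniqueness of row canonical forms. The columns of a full column rank matrix
`A` stay independent modulo `π`, so `A` is the left block of an invertible `P`
(`exists_unit_extension`), and `AX` is `P` times `X` padded with zero rows. The padded `X` is row
canonical, and two row canonical matrices with the same row span are equal
(`IsRowCanonical.eq_of_vecMul`), so reduction of `AX` recovers `X`. The encoder is bijective because
principal forms have an entrywise description (`principalForms_eq`): with `e_κ = shapeExp κ`, an
off-diagonal entry `(a, b)` has free digits exactly at `max (e_κ a) (e_μ b) ≤ i < e_κ b`, that is,
where `a < κ_i ≤ b < μ_i`. These are the message positions. That the prescribed diagonal consists of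
pivots follows by comparing two counts of the row span.

For part (b), `p(Y | X)` depends only on the left equivalence class of `X`, since `A ↦ AU` permutes
the full column rank matrices. Hence the capacity is at most `log_q` of the number of classes.
Gaussian elimination puts an echelon form in each class. For fixed pivot degrees `l` and columns
`c`, the `t`-th digits are free in at most `k (μ_t - k)` places, where `k ≤ n` pivots have degree at
most `t`; this is largest at `k = κ_t`. There are `((s + 1) m)^n` choices of `(l, c)`, so the
capacity is at most the rate plus `n log_q ((s + 1) m)`. The code has zero error, so its rate is a
lower bound. After division by `n |μ|` the gap is of order `log m / m`, and the limits agree. -/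

noncomputable section

namespace MMC

/-! ### Degrees and divisibility in a finite chain ring -/

section Degree

variable {R : Type*} [CommRing R] {π : R} {s : ℕ}

theorem le_deg_iff {k : ℕ} {a : R} (hk : k ≤ s) : k ≤ deg π s a ↔ π ^ k ∣ a := by
  classical
  constructor
  · intro h
    have : π ^ deg π s a ∣ a :=
      Nat.findGreatest_spec (P := fun l => π ^ l ∣ a) (Nat.zero_le s) (by simp)
    exact (pow_dvd_pow _ h).trans this
  · intro h
    exact Nat.le_findGreatest hk h

theorem deg_le {a : R} : deg π s a ≤ s := by
  classical exact Nat.findGreatest_le s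

theorem pow_deg_dvd {a : R} : π ^ deg π s a ∣ a := (le_deg_iff deg_le).1 le_rfl

theorem deg_zero : deg π s (0 : R) = s := le_antisymm deg_le ((le_deg_iff le_rfl).2 (by simp))

end Degree

namespace IsFiniteChainRing

variable {R : Type*} [CommRing R] [Finite R] {π : R} {q s : ℕ}

theorem pos (hR : IsFiniteChainRing R π q s) : 0 < s := hR.nilpotency.1.1

theorem pow_eq_zero (hR : IsFiniteChainRing R π q s) {k : ℕ} (hk : s ≤ k) : π ^ k = 0 :=
  pow_eq_zero_of_le hk hR.nilpotency.1.2

theorem pow_ne_zero (hR : IsFiniteChainRing R π q s) {k : ℕ} (hk : k < s) : π ^ k ≠ 0 := by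
  have := hR.nontrivial
  intro h
  rcases Nat.eq_zero_or_pos k with rfl | hk0
  · simp at h
  · exact absurd (hR.nilpotency.2 ⟨hk0, h⟩) (by omega)

/-- Any maximal ideal is comparable with `⟨π⟩` and hence equal to it, so `R` is local. -/
theorem isUnit_of_not_dvd (hR : IsFiniteChainRing R π q s) {a : R} (ha : ¬ π ∣ a) : IsUnit a := by
  by_contra hu
  obtain ⟨J, hJ, haJ⟩ := exists_max_ideal_of_mem_nonunits hu
  have : J = Ideal.span {π} := by
    rcases hR.chain J (Ideal.span {π}) with h | h
    · exact hJ.eq_of_le hR.maximal.ne_top h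
    · exact (hR.maximal.eq_of_le hJ.ne_top h).symm
  rw [this, Ideal.mem_span_singleton] at haJ
  exact ha haJ

theorem exists_pow_mul_unit (hR : IsFiniteChainRing R π q s) {a : R} (ha : a ≠ 0) :
    ∃ k < s, ∃ u : Rˣ, a = π ^ k * u := by
  classical
  have hex : ∃ k, ¬ π ^ (k + 1) ∣ a := by
    refine ⟨s, fun h => ha ?_⟩
    rwa [hR.pow_eq_zero (by omega), zero_dvd_iff] at h
  have hmin : π ^ Nat.find hex ∣ a := by
    rcases h : Nat.find hex with _ | k
    · simp
    · by_contra hk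
      exact Nat.find_min hex (m := k) (by omega) hk
  obtain ⟨b, hb⟩ := hmin
  have hub : IsUnit b := by
    refine hR.isUnit_of_not_dvd fun ⟨c, hc⟩ => Nat.find_spec hex ⟨c, ?_⟩
    rw [pow_succ, mul_assoc, ← hc, ← hb]
  refine ⟨Nat.find hex, ?_, hub.unit, hb⟩
  by_contra hs
  rw [hR.pow_eq_zero (by omega), zero_mul] at hb
  exact ha hb

/-- Otherwise, multiplying by `π ^ (s - 1 - i)` would make `π ^ (s - 1)` a multiple of `π ^ s = 0`.
-/
theorem not_pow_dvd_pow (hR : IsFiniteChainRing R π q s) {i j : ℕ} (hij : i < j) (hi : i < s) :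
    ¬ π ^ j ∣ π ^ i := by
  rintro ⟨c, hc⟩
  refine hR.pow_ne_zero (k := s - 1) (by have := hR.pos; omega) ?_
  have : π ^ (s - 1) = π ^ (s - 1 - i) * π ^ i := by rw [← pow_add]; congr 1; omega
  rw [this, hc, ← mul_assoc, ← pow_add, hR.pow_eq_zero (by omega), zero_mul]

/-- Since `R` has zero divisors, `π ^ k` can be cancelled only while exponents stay at most `s`. The
case `k + j = s` describes the annihilator of `π ^ k`. -/
theorem pow_dvd_of_pow_add_dvd (hR : IsFiniteChainRing R π q s) {k j : ℕ} {x : R}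
    (hs : k + j ≤ s) (h : π ^ (k + j) ∣ π ^ k * x) : π ^ j ∣ x := by
  rcases eq_or_ne x 0 with rfl | hx
  · simp
  obtain ⟨i, hi, u, rfl⟩ := hR.exists_pow_mul_unit hx
  by_contra hn
  have hij : i < j := by
    by_contra hij
    exact hn (Dvd.dvd.mul_right (pow_dvd_pow _ (by omega)) _)
  rw [← mul_assoc, ← pow_add, Units.dvd_mul_right] at h
  exact hR.not_pow_dvd_pow (by omega) (by omega) h

theorem dvd_of_pow_mul_eq_zero (hR : IsFiniteChainRing R π q s) {k : ℕ} {x : R} (hk : k ≤ s)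
    (h : π ^ k * x = 0) : π ^ (s - k) ∣ x :=
  hR.pow_dvd_of_pow_add_dvd (k := k) (by omega) (by simp [h])

theorem deg_eq_iff (hR : IsFiniteChainRing R π q s) {a : R} {k : ℕ} (hk : k < s) :
    deg π s a = k ↔ ∃ u : Rˣ, a = π ^ k * u := by
  constructor
  · rintro rfl
    have ha : a ≠ 0 := by
      rintro rfl
      have : s ≤ deg π s (0 : R) := (le_deg_iff le_rfl).2 (by simp)
      omega
    obtain ⟨i, hi, u, hu⟩ := hR.exists_pow_mul_unit ha
    have h1 : i ≤ deg π s a := (le_deg_iff hi.le).2 (hu ▸ Dvd.intro _ rfl)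
    have h2 : ¬ i < deg π s a := fun h => by
      have := pow_deg_dvd (π := π) (s := s) (a := a)
      nth_rewrite 2 [hu] at this
      rw [Units.dvd_mul_right] at this
      exact hR.not_pow_dvd_pow h hi this
    have : deg π s a = i := by omega
    rw [this]
    exact ⟨u, hu⟩
  · rintro ⟨u, rfl⟩
    have h1 : k ≤ deg π s (π ^ k * u) := (le_deg_iff hk.le).2 (Dvd.intro _ rfl)
    by_contra h
    have := (le_deg_iff (π := π) (a := π ^ k * (u : R)) (k := k + 1) hk).1 (by omega)
    rw [Units.dvd_mul_right] at this
    exact hR.not_pow_dvd_pow (by omega) hk this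

theorem deg_pow (hR : IsFiniteChainRing R π q s) {k : ℕ} (hk : k < s) : deg π s (π ^ k) = k :=
  (hR.deg_eq_iff hk).2 ⟨1, by simp⟩

theorem deg_lt_iff (hR : IsFiniteChainRing R π q s) {a : R} : deg π s a < s ↔ a ≠ 0 := by
  constructor
  · rintro h rfl
    rw [deg_zero] at h; omega
  · intro ha
    by_contra h
    have := (le_deg_iff (π := π) (s := s) (a := a) le_rfl).1 (by omega)
    rw [hR.pow_eq_zero le_rfl, zero_dvd_iff] at this
    exact ha this

end IsFiniteChainRing

/-! ### Digit expansions in powers of `π` -/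

namespace IsResidueSet

variable {R : Type*} [CommRing R] {π : R} {q s : ℕ} {Res : Set R}

theorem eq_of_dvd_sub (hRes : IsResidueSet π Res) {a b : R} (ha : a ∈ Res) (hb : b ∈ Res)
    (h : π ∣ a - b) : a = b := by
  obtain ⟨r, -, hr⟩ := hRes.existsUnique a
  exact (hr a ⟨ha, by simp⟩).trans (hr b ⟨hb, Ideal.mem_span_singleton.2 h⟩).symm

theorem exists_digits_approx (hRes : IsResidueSet π Res) (a : R) (l : ℕ) :
    ∃ d : ℕ → R, (∀ i, d i ∈ Res) ∧ π ^ l ∣ a - ∑ i ∈ Finset.range l, d i * π ^ i := by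
  induction l with
  | zero => exact ⟨fun _ => 0, fun _ => hRes.zero_mem, by simp⟩
  | succ l ih =>
    obtain ⟨d, hd, b, hb⟩ := ih
    obtain ⟨r, ⟨hr, hbr⟩, -⟩ := hRes.existsUnique b
    obtain ⟨c, hc⟩ := Ideal.mem_span_singleton.1 hbr
    -- All digits from `l` on are set to `r`; only the one at `l` enters the sum.
    refine ⟨fun i => if i < l then d i else r, fun i => ?_, c, ?_⟩
    · dsimp only; split_ifs
      exacts [hd i, hr]
    · have hs : ∑ i ∈ Finset.range l, (if i < l then d i else r) * π ^ i =
          ∑ i ∈ Finset.range l, d i * π ^ i :=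
        Finset.sum_congr rfl fun i hi => by rw [if_pos (Finset.mem_range.1 hi)]
      rw [Finset.sum_range_succ, hs]
      simp only [lt_irrefl, if_false]
      rw [← sub_sub, hb, pow_succ, mul_assoc, ← hc]
      ring

theorem exists_mem_residuesPow (hRes : IsResidueSet π Res) (a : R) (l : ℕ) :
    ∃ x ∈ residuesPow π Res l, π ^ l ∣ a - x := by
  obtain ⟨d, hd, h⟩ := hRes.exists_digits_approx a l
  exact ⟨_, ⟨d, hd, rfl⟩, h⟩

variable [Finite R]

theorem card (hRes : IsResidueSet π Res) (hR : IsFiniteChainRing R π q s) : Nat.card Res = q := by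
  rw [← hR.card_residue]
  refine Nat.card_congr (Equiv.ofBijective (fun r : Res => Ideal.Quotient.mk _ (r : R)) ⟨?_, ?_⟩)
  · rintro ⟨a, ha⟩ ⟨b, hb⟩ hab
    have hab' : a - b ∈ Ideal.span {π} := Ideal.Quotient.eq.1 hab
    obtain ⟨r, -, hr⟩ := hRes.existsUnique a
    exact Subtype.ext ((hr a ⟨ha, by simp⟩).trans (hr b ⟨hb, hab'⟩).symm)
  · intro x
    obtain ⟨a, rfl⟩ := Ideal.Quotient.mk_surjective x
    obtain ⟨r, ⟨hr, har⟩, -⟩ := hRes.existsUnique a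
    exact ⟨⟨r, hr⟩, (Ideal.Quotient.eq.2 har).symm⟩

theorem exists_digits (hRes : IsResidueSet π Res) (hR : IsFiniteChainRing R π q s) (a : R) :
    ∃ d : ℕ → R, (∀ i, d i ∈ Res) ∧ a = ∑ i ∈ Finset.range s, d i * π ^ i := by
  obtain ⟨d, hd, h⟩ := hRes.exists_digits_approx a s
  rw [hR.pow_eq_zero le_rfl, zero_dvd_iff, sub_eq_zero] at h
  exact ⟨d, hd, h⟩

/-- Modulo `π ^ l` the lower digits agree by induction and cancel; cancelling `π ^ l` then leaves a
congruence modulo `π` between the top digits. -/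
theorem digits_unique (hRes : IsResidueSet π Res) (hR : IsFiniteChainRing R π q s)
    {a b : ℕ → R} {l : ℕ} (hl : l ≤ s) (ha : ∀ i, a i ∈ Res) (hb : ∀ i, b i ∈ Res)
    (h : π ^ l ∣ ∑ i ∈ Finset.range l, a i * π ^ i - ∑ i ∈ Finset.range l, b i * π ^ i) :
    ∀ i < l, a i = b i := by
  induction l with
  | zero => intro i hi; omega
  | succ l ih =>
    have h1 : π ^ l ∣ ∑ i ∈ Finset.range l, a i * π ^ i - ∑ i ∈ Finset.range l, b i * π ^ i := by
      have h2 := (pow_dvd_pow π (Nat.le_succ l)).trans h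
      rw [Finset.sum_range_succ, Finset.sum_range_succ] at h2
      have h3 : π ^ l ∣ a l * π ^ l - b l * π ^ l := ⟨a l - b l, by ring⟩
      convert dvd_sub h2 h3 using 1
      ring
    have ih' := ih (by omega) h1
    intro i hi
    rcases Nat.lt_succ_iff_lt_or_eq.1 hi with hi | rfl
    · exact ih' i hi
    · rw [Finset.sum_range_succ, Finset.sum_range_succ, Finset.sum_congr rfl
        (fun j hj => by rw [ih' j (Finset.mem_range.1 hj)])] at h
      refine hRes.eq_of_dvd_sub (ha i) (hb i) ?_
      have := hR.pow_dvd_of_pow_add_dvd (k := i) (j := 1) (x := a i - b i) hl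
        (by convert h using 1; ring)
      simpa using this

theorem eq_of_mem_residuesPow (hRes : IsResidueSet π Res) (hR : IsFiniteChainRing R π q s)
    {x y : R} {l : ℕ} (hl : l ≤ s) (hx : x ∈ residuesPow π Res l) (hy : y ∈ residuesPow π Res l)
    (h : π ^ l ∣ x - y) : x = y := by
  obtain ⟨a, ha, rfl⟩ := hx
  obtain ⟨b, hb, rfl⟩ := hy
  exact Finset.sum_congr rfl fun i hi => by
    rw [hRes.digits_unique hR hl ha hb h i (Finset.mem_range.1 hi)]

theorem mem_residuesPow_top (hRes : IsResidueSet π Res) (hR : IsFiniteChainRing R π q s) (a : R) :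
    a ∈ residuesPow π Res s := hRes.exists_digits hR a

/-- An element of `ℛ(π^l)` divisible by `π^k` has digits supported in `[k, l)`. -/
theorem exists_digits_of_dvd (hRes : IsResidueSet π Res) (hR : IsFiniteChainRing R π q s)
    {x : R} {k l : ℕ} (hk : k ≤ s) (hl : l ≤ s) (hx : x ∈ residuesPow π Res l)
    (hkx : π ^ k ∣ x) :
    ∃ d : ℕ → R, (∀ i, d i ∈ Res) ∧ (∀ i, d i ≠ 0 → k ≤ i ∧ i < l) ∧
      x = ∑ i ∈ Finset.range s, d i * π ^ i := by
  classical
  obtain ⟨a, ha, rfl⟩ := hx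
  have hsum : ∑ i ∈ Finset.range l, a i * π ^ i =
      ∑ i ∈ Finset.range s, (if i < l then a i else 0) * π ^ i := by
    rw [← Finset.sum_subset (Finset.range_mono hl)]
    · exact Finset.sum_congr rfl fun i hi => by rw [if_pos (Finset.mem_range.1 hi)]
    · intro i _ hi
      rw [if_neg (by simpa using hi), zero_mul]
  have hmem : ∀ i, (if i < l then a i else 0) ∈ Res := fun i => by
    split_ifs
    exacts [ha i, hRes.zero_mem]
  refine ⟨fun i => if i < l then a i else 0, hmem, fun i hi => ?_, hsum⟩
  have hil : i < l := by
    by_contra h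
    simp [h] at hi
  refine ⟨?_, hil⟩
  by_contra hik
  refine hi ?_
  -- Modulo `π ^ k` the terms from `k` on vanish, so the first `k` digits are compared with the
  -- all-zero expansion.
  refine hRes.digits_unique hR (l := k) (b := fun _ => 0) hk hmem
    (fun _ => hRes.zero_mem) ?_ i (by omega)
  rw [hsum] at hkx
  rw [← Finset.sum_range_add_sum_Ico _ hk] at hkx
  simp only [zero_mul, Finset.sum_const_zero, sub_zero]
  refine (dvd_add_left (Finset.dvd_sum fun j hj => ?_)).1 hkx
  exact Dvd.dvd.mul_left (pow_dvd_pow _ (Finset.mem_Ico.1 hj).1) _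

theorem card_residuesPow (hRes : IsResidueSet π Res) (hR : IsFiniteChainRing R π q s)
    {l : ℕ} (hl : l ≤ s) : Nat.card (residuesPow π Res l) = q ^ l := by
  classical
  have : Nat.card (Fin l → Res) = q ^ l := by
    rw [Nat.card_fun, hRes.card hR, Nat.card_eq_fintype_card, Fintype.card_fin]
  rw [← this]
  let ext : (Fin l → Res) → ℕ → R := fun f i => if h : i < l then (f ⟨i, h⟩ : R) else 0
  have hext : ∀ f i, ext f i ∈ Res := fun f i => by
    simp only [ext]
    split_ifs
    exacts [(f _).2, hRes.zero_mem]
  refine (Nat.card_congr (Equiv.ofBijective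
    (fun f : Fin l → Res => (⟨_, ext f, hext f, rfl⟩ : residuesPow π Res l)) ⟨?_, ?_⟩)).symm
  · intro f g hfg
    have h := hRes.digits_unique hR hl (hext f) (hext g)
      (by rw [show ∑ i ∈ Finset.range l, ext f i * π ^ i = ∑ i ∈ Finset.range l, ext g i * π ^ i
            from congrArg Subtype.val hfg, sub_self]; exact dvd_zero _)
    funext i
    have := h i i.2
    simpa [ext, Subtype.ext_iff] using this
  · rintro ⟨_, a, ha, rfl⟩
    refine ⟨fun i => ⟨a i, ha i⟩, Subtype.ext ?_⟩
    show ∑ i ∈ Finset.range l, _ = _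
    refine Finset.sum_congr rfl fun i hi => ?_
    simp [ext, Finset.mem_range.1 hi]

end IsResidueSet

theorem IsFiniteChainRing.one_lt {R : Type*} [CommRing R] [Finite R] {π : R} {q s : ℕ}
    (hR : IsFiniteChainRing R π q s) : 1 < q := by
  rw [← hR.card_residue]
  have : Nontrivial (R ⧸ Ideal.span {π}) := Ideal.Quotient.nontrivial_iff.2 hR.maximal.ne_top
  have : Finite (R ⧸ Ideal.span {π}) := Quotient.finite _
  exact Finite.one_lt_card

/-! ### Leading terms of vectors -/

section Leading

variable {R : Type*} [CommRing R] {π : R} {s m : ℕ}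

/-- The vector `x` has degree `l < s`, and `c` is the first index at which this is attained. -/
structure LeadsAt (π : R) (s : ℕ) {m : ℕ} (x : Fin m → R) (l : ℕ) (c : Fin m) : Prop where
  lt : l < s
  unit : ∃ u : Rˣ, x c = π ^ l * u
  dvd : ∀ j, π ^ l ∣ x j
  dvd_lt : ∀ j, j < c → π ^ (l + 1) ∣ x j

/-- Up to column `c` the perturbation has strictly higher degree, so it changes the unit factor of
the pivot only by a multiple of `π`. The hypothesis `hu` is the part of locality that is needed. -/
theorem LeadsAt.add_left {x y : Fin m → R} {l : ℕ} {c : Fin m}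
    (hx : LeadsAt π s x l c) (hy : ∀ j, π ^ l ∣ y j) (hy' : ∀ j, j ≤ c → π ^ (l + 1) ∣ y j)
    (hu : ∀ (u : Rˣ) (r : R), IsUnit (u + π * r)) : LeadsAt π s (x + y) l c where
  lt := hx.lt
  unit := by
    obtain ⟨u, hxu⟩ := hx.unit
    obtain ⟨r, hr⟩ := hy' c le_rfl
    refine ⟨(hu u r).unit, ?_⟩
    rw [Pi.add_apply, hxu, hr, IsUnit.unit_spec]; ring
  dvd j := dvd_add (hx.dvd j) (hy j)
  dvd_lt j hj := dvd_add (hx.dvd_lt j hj) (hy' j hj.le)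

variable [Finite R] {q : ℕ}

theorem IsFiniteChainRing.isUnit_add (hR : IsFiniteChainRing R π q s) (u : Rˣ) (r : R) :
    IsUnit ((u : R) + π * r) := by
  refine hR.isUnit_of_not_dvd fun h => ?_
  have h1 : π ∣ (u : R) := (dvd_add_left (Dvd.intro _ rfl)).1 h
  exact hR.maximal.ne_top ((Ideal.eq_top_of_isUnit_mem _ (Ideal.mem_span_singleton.2 h1) u.isUnit))

theorem LeadsAt.apply_ne_zero (hR : IsFiniteChainRing R π q s) {x : Fin m → R} {l : ℕ} {c : Fin m}
    (hx : LeadsAt π s x l c) : x c ≠ 0 := by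
  obtain ⟨u, hu⟩ := hx.unit
  rw [hu, Ne, Units.mul_left_eq_zero]
  exact hR.pow_ne_zero hx.lt

theorem LeadsAt.not_dvd (hR : IsFiniteChainRing R π q s) {x : Fin m → R} {l k : ℕ} {c : Fin m}
    (hx : LeadsAt π s x l c) (hk : l < k) : ¬ π ^ k ∣ x c := by
  obtain ⟨u, hu⟩ := hx.unit
  rw [hu, Units.dvd_mul_right]
  exact hR.not_pow_dvd_pow hk hx.lt

theorem LeadsAt.unique (hR : IsFiniteChainRing R π q s) {x : Fin m → R} {l l' : ℕ} {c c' : Fin m}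
    (h : LeadsAt π s x l c) (h' : LeadsAt π s x l' c') : l = l' ∧ c = c' := by
  have hl : l = l' := by
    rcases lt_trichotomy l l' with hl | hl | hl
    · exact absurd (h'.dvd c) (h.not_dvd hR hl)
    · exact hl
    · exact absurd (h.dvd c') (h'.not_dvd hR hl)
  subst hl
  refine ⟨rfl, ?_⟩
  rcases lt_trichotomy c c' with hc | hc | hc
  · exact absurd (h'.dvd_lt c hc) (h.not_dvd hR (Nat.lt_succ_self l))
  · exact hc
  · exact absurd (h.dvd_lt c' hc) (h'.not_dvd hR (Nat.lt_succ_self l))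

theorem isPivot_iff (hR : IsFiniteChainRing R π q s) {n : ℕ} {A : Matrix (Fin n) (Fin m) R}
    {i : Fin n} {c : Fin m} :
    IsPivot π s A i c ↔ LeadsAt π s (A i) (deg π s (A i c)) c := by
  constructor
  · rintro ⟨h0, h1, h2⟩
    obtain ⟨j, hj⟩ := Function.ne_iff.1 h0
    have hlt : deg π s (A i c) < s := (h1 j).trans_lt (hR.deg_lt_iff.2 hj)
    exact ⟨hlt, (hR.deg_eq_iff hlt).1 rfl, fun j => (le_deg_iff hlt.le).1 (h1 j),
      fun j hj => (le_deg_iff hlt).1 (h2 j hj)⟩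
  · intro h
    exact ⟨fun h0 => h.apply_ne_zero hR (congrFun h0 c), fun j => (le_deg_iff h.lt.le).2 (h.dvd j),
      fun j hj => (le_deg_iff h.lt).2 (h.dvd_lt j hj)⟩

theorem LeadsAt.deg_eq (hR : IsFiniteChainRing R π q s) {x : Fin m → R} {l : ℕ} {c : Fin m}
    (h : LeadsAt π s x l c) : deg π s (x c) = l := (hR.deg_eq_iff h.lt).2 h.unit

theorem LeadsAt.isPivot (hR : IsFiniteChainRing R π q s) {n : ℕ} {A : Matrix (Fin n) (Fin m) R}
    {i : Fin n} {l : ℕ} {c : Fin m} (h : LeadsAt π s (A i) l c) : IsPivot π s A i c := by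
  rw [isPivot_iff hR, h.deg_eq hR]
  exact h

theorem exists_leadsAt (hR : IsFiniteChainRing R π q s) {x : Fin m → R} (hx : x ≠ 0) :
    ∃ l c, LeadsAt π s x l c := by
  obtain ⟨j, hj⟩ := Function.ne_iff.1 hx
  -- The lexicographic minimum of (degree, column) takes the least degree first, then the earliest
  -- column.
  obtain ⟨c, -, hc⟩ := Finset.exists_min_image Finset.univ
    (fun j => toLex (deg π s (x j), j)) ⟨j, Finset.mem_univ j⟩
  have h1 : ∀ j, deg π s (x c) ≤ deg π s (x j) := fun j => by
    rcases Prod.Lex.toLex_le_toLex.1 (hc j (Finset.mem_univ j)) with h | h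
    exacts [h.le, h.1.le]
  have h2 : ∀ j, j < c → deg π s (x c) < deg π s (x j) := fun j hj => by
    rcases Prod.Lex.toLex_le_toLex.1 (hc j (Finset.mem_univ j)) with h | h
    exacts [h, absurd hj (not_lt.2 h.2)]
  exact ⟨_, c, (isPivot_iff hR (A := fun _ : Fin 1 => x) (i := 0)).1 ⟨hx, h1, h2⟩⟩

/-- Leading terms are ordered by degree, then by column. Distinct columns exclude a tie, so the
smaller leading term survives without cancellation. -/
theorem LeadsAt.add (hR : IsFiniteChainRing R π q s) {x y : Fin m → R} {l k : ℕ} {c d : Fin m}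
    (hx : LeadsAt π s x l c) (hy : LeadsAt π s y k d) (hcd : c ≠ d) :
    LeadsAt π s (x + y) l c ∨ LeadsAt π s (x + y) k d := by
  have key : ∀ {x y : Fin m → R} {l k : ℕ} {c d : Fin m}, LeadsAt π s x l c → LeadsAt π s y k d →
      (l < k ∨ l = k ∧ c < d) → LeadsAt π s (x + y) l c := by
    intro x y l k c d hx hy h
    rcases h with h | ⟨rfl, h⟩
    · exact hx.add_left (fun j => (pow_dvd_pow _ h.le).trans (hy.dvd j))
        (fun j _ => (pow_dvd_pow _ h).trans (hy.dvd j)) hR.isUnit_add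
    · exact hx.add_left hy.dvd (fun j hj => hy.dvd_lt j (hj.trans_lt h)) hR.isUnit_add
  rcases lt_trichotomy l k with h | h | h
  · exact Or.inl (key hx hy (Or.inl h))
  · rcases lt_or_gt_of_ne hcd with h' | h'
    · exact Or.inl (key hx hy (Or.inr ⟨h, h'⟩))
    · exact Or.inr (add_comm x y ▸ key hy hx (Or.inr ⟨h.symm, h'⟩))
  · exact Or.inr (add_comm x y ▸ key hy hx (Or.inl h))

theorem LeadsAt.sum (hR : IsFiniteChainRing R π q s) {ι : Type*} {z : ι → Fin m → R} {l : ι → ℕ}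
    {c : ι → Fin m} {S : Finset ι} (hS : S.Nonempty) (hz : ∀ i ∈ S, LeadsAt π s (z i) (l i) (c i))
    (hc : Set.InjOn c S) : ∃ i ∈ S, LeadsAt π s (∑ i ∈ S, z i) (l i) (c i) := by
  classical
  induction hS using Finset.Nonempty.cons_induction with
  | singleton a => exact ⟨a, by simp, by simpa using hz a (by simp)⟩
  | cons a S ha hS ih =>
    obtain ⟨i, hi, h⟩ := ih (fun i hi => hz i (by simp [hi])) (hc.mono (by simp))
    rw [Finset.sum_cons]
    have hai : c a ≠ c i := fun h => ha (hc (by simp) (by simp [hi]) h ▸ hi)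
    rcases (hz a (by simp)).add hR h hai with h | h
    exacts [⟨a, by simp, h⟩, ⟨i, by simp [hi], h⟩]

theorem LeadsAt.smul (hR : IsFiniteChainRing R π q s) {x : Fin m → R} {l : ℕ} {c : Fin m}
    (hx : LeadsAt π s x l c) {y : R} (hy : y • x ≠ 0) : ∃ k ≥ l, LeadsAt π s (y • x) k c := by
  have hy0 : y ≠ 0 := by rintro rfl; simp at hy
  obtain ⟨k, -, u, rfl⟩ := hR.exists_pow_mul_unit hy0
  obtain ⟨v, hv⟩ := hx.unit
  have hdvd : ∀ j i, π ^ i ∣ x j → π ^ (k + i) ∣ ((π ^ k * u : R) • x) j := fun j i hj => by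
    rw [Pi.smul_apply, smul_eq_mul, pow_add, mul_assoc]
    exact mul_dvd_mul_left _ (Dvd.dvd.mul_left hj _)
  refine ⟨k + l, by omega, ?_, ⟨u * v, ?_⟩, fun j => hdvd j l (hx.dvd j),
    fun j hj => hdvd j (l + 1) (hx.dvd_lt j hj)⟩
  · by_contra hs
    refine hy (funext fun j => ?_)
    have := hdvd j l (hx.dvd j)
    rwa [hR.pow_eq_zero (by omega), zero_dvd_iff] at this
  · rw [Pi.smul_apply, hv, smul_eq_mul, Units.val_mul]; ring

end Leading

/-! ### Uniqueness of row canonical forms -/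

section RowCanonical

variable {R : Type*} [CommRing R] [Finite R] {π : R} {q s n m : ℕ} {Res : Set R}
  {A B : Matrix (Fin n) (Fin m) R}

namespace IsRowCanonical

theorem apply_lead (hA : IsRowCanonical π s Res A) (hR : IsFiniteChainRing R π q s) {i : Fin n}
    {l : ℕ} {c : Fin m} (h : LeadsAt π s (A i) l c) : A i c = π ^ l := by
  obtain ⟨k, hk, hkA⟩ := hA.pivot_form i c (h.isPivot hR)
  have := h.deg_eq hR
  rw [hkA, hR.deg_pow hk] at this
  rw [hkA, this]

theorem row_lt (hA : IsRowCanonical π s Res A) (hR : IsFiniteChainRing R π q s) {i i' : Fin n}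
    {l l' : ℕ} {c c' : Fin m} (h : LeadsAt π s (A i) l c) (h' : LeadsAt π s (A i') l' c')
    (hlt : l < l' ∨ l = l' ∧ c < c') : i < i' := by
  rcases hlt with hl | ⟨hl, hc⟩
  · exact hA.order_diff i i' c c' (h.isPivot hR) (h'.isPivot hR) (by
      rwa [h.deg_eq hR, h'.deg_eq hR])
  · exact hA.order_same i i' c c' (h.isPivot hR) (h'.isPivot hR) (by
      rwa [h.deg_eq hR, h'.deg_eq hR]) hc

theorem apply_below (hA : IsRowCanonical π s Res A) (hR : IsFiniteChainRing R π q s) {i i' : Fin n}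
    {l : ℕ} {c : Fin m} (h : LeadsAt π s (A i) l c) (hi : i < i') : A i' c = 0 :=
  hA.below_pivot i c (h.isPivot hR) i' hi

theorem apply_above (hA : IsRowCanonical π s Res A) (hR : IsFiniteChainRing R π q s) {i i' : Fin n}
    {l : ℕ} {c : Fin m} (h : LeadsAt π s (A i) l c) (hi : i' < i) : A i' c ∈ residuesPow π Res l :=
  hA.above_pivot i c (h.isPivot hR) l h.lt (hA.apply_lead hR h) i' hi

theorem lead_injective (hA : IsRowCanonical π s Res A) (hR : IsFiniteChainRing R π q s)
    {i i' : Fin n} {l l' : ℕ} {c : Fin m} (h : LeadsAt π s (A i) l c)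
    (h' : LeadsAt π s (A i') l' c) : i = i' := by
  rcases lt_trichotomy i i' with hi | hi | hi
  · exact absurd (hA.apply_below hR h hi) (h'.apply_ne_zero hR)
  · exact hi
  · exact absurd (hA.apply_below hR h' hi) (h.apply_ne_zero hR)

/-- The leading position of a vector in the row span is the column of a pivot of at most the same
degree. -/
theorem exists_lead_of_vecMul (hA : IsRowCanonical π s Res A) (hR : IsFiniteChainRing R π q s)
    {y : Fin n → R} {l : ℕ} {c : Fin m} (h : LeadsAt π s (Matrix.vecMul y A) l c) :
    ∃ j, ∃ k ≤ l, LeadsAt π s (A j) k c := by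
  classical
  -- Scaling a row keeps its leading column unless the row becomes zero. Once zero terms are
  -- dropped, the leading columns are distinct and `LeadsAt.sum` applies.
  have hsum : Matrix.vecMul y A = ∑ i ∈ Finset.univ.filter (fun i => y i • A i ≠ 0), y i • A i := by
    rw [Finset.sum_filter_ne_zero, Matrix.vecMul_eq_sum]
  have hlead : ∀ i, ∃ p : ℕ × ℕ × Fin m, y i • A i ≠ 0 →
      LeadsAt π s (A i) p.1 p.2.2 ∧ p.1 ≤ p.2.1 ∧ LeadsAt π s (y i • A i) p.2.1 p.2.2 := by
    intro i
    by_cases hi : y i • A i ≠ 0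
    · have hAi : A i ≠ 0 := fun h0 => hi (by rw [h0, smul_zero])
      obtain ⟨l', c', hl'⟩ := exists_leadsAt hR hAi
      obtain ⟨k', hk', h'⟩ := hl'.smul hR hi
      exact ⟨(l', k', c'), fun _ => ⟨hl', hk', h'⟩⟩
    · exact ⟨(0, 0, c), fun h => absurd h hi⟩
  choose p hp using hlead
  have hne : (Finset.univ.filter (fun i => y i • A i ≠ 0)).Nonempty := by
    by_contra h0
    rw [Finset.not_nonempty_iff_eq_empty] at h0
    rw [h0, Finset.sum_empty] at hsum
    exact h.apply_ne_zero hR (congrFun hsum c)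
  obtain ⟨i, hi, hi'⟩ := LeadsAt.sum hR hne (l := fun i => (p i).2.1) (c := fun i => (p i).2.2)
    (fun i hi => (hp i (Finset.mem_filter.1 hi).2).2.2) (by
      intro i hi j hj hij
      have hi' := (hp i (Finset.mem_filter.1 hi).2).1
      have hj' := (hp j (Finset.mem_filter.1 hj).2).1
      simp only at hij
      rw [hij] at hi'
      exact hA.lead_injective hR hi' hj')
  rw [← hsum] at hi'
  obtain ⟨h1, h2⟩ := h.unique hR hi'
  have := hp i (Finset.mem_filter.1 hi).2
  exact ⟨i, (p i).1, h1 ▸ this.2.1, h2 ▸ this.1⟩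

/-- Row `i` of `B` leads in the column of some pivot of `A`, in row `j`. If `j < i`, then `B` has a
pivot there too and vanishes below it, a contradiction; so `i ≤ j`, and the pivot of row `i` of `A`
comes no later than that of row `j`. -/
theorem exists_lead_le (hA : IsRowCanonical π s Res A) (hB : IsRowCanonical π s Res B)
    (hR : IsFiniteChainRing R π q s) (hBA : ∀ i, ∃ y, B i = Matrix.vecMul y A) {i : Fin n}
    (ih : ∀ j < i, ∀ l c, LeadsAt π s (A j) l c → LeadsAt π s (B j) l c) {l : ℕ} {c : Fin m}
    (h : LeadsAt π s (B i) l c) :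
    ∃ k d, LeadsAt π s (A i) k d ∧ (k < l ∨ k = l ∧ d ≤ c) := by
  obtain ⟨y, hy⟩ := hBA i
  obtain ⟨j, k, hkl, hj⟩ := hA.exists_lead_of_vecMul hR (hy ▸ h)
  have hij : i ≤ j := by
    by_contra hlt
    exact h.apply_ne_zero hR (hB.apply_below hR (ih j (not_le.1 hlt) k c hj) (not_le.1 hlt))
  have hAi : A i ≠ 0 := fun h0 =>
    absurd (hA.zero_below j i (fun h => hj.apply_ne_zero hR (congrFun h c)) h0) (not_lt.2 hij)
  obtain ⟨k', d, hd⟩ := exists_leadsAt hR hAi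
  refine ⟨k', d, hd, ?_⟩
  have h1 : ¬ (k < k' ∨ k = k' ∧ c < d) := fun h => absurd (hA.row_lt hR hj hd h) (not_lt.2 hij)
  push Not at h1
  rcases lt_or_eq_of_le (h1.1.trans hkl) with h2 | h2
  · exact Or.inl h2
  · exact Or.inr ⟨h2, h1.2 (by omega)⟩

/-- By induction on the row, `exists_lead_le` in both directions bounds each pivot by the other in
the order (degree, column). -/
theorem leadsAt_iff (hA : IsRowCanonical π s Res A) (hB : IsRowCanonical π s Res B)
    (hR : IsFiniteChainRing R π q s) (hBA : ∀ i, ∃ y, B i = Matrix.vecMul y A)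
    (hAB : ∀ i, ∃ y, A i = Matrix.vecMul y B) (i : Fin n) :
    ∀ l c, LeadsAt π s (A i) l c ↔ LeadsAt π s (B i) l c := by
  induction i using WellFoundedLT.induction with
  | ind i ih =>
    have key : ∀ {A B : Matrix (Fin n) (Fin m) R}, IsRowCanonical π s Res A →
        IsRowCanonical π s Res B → (∀ i, ∃ y, B i = Matrix.vecMul y A) →
        (∀ i, ∃ y, A i = Matrix.vecMul y B) →
        (∀ j < i, ∀ l c, LeadsAt π s (A j) l c ↔ LeadsAt π s (B j) l c) →
        ∀ l c, LeadsAt π s (A i) l c → LeadsAt π s (B i) l c := by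
      intro A B hA hB hBA hAB ih l c h
      obtain ⟨k, d, hd, hle⟩ := hB.exists_lead_le hA hR hAB (fun j hj l c => (ih j hj l c).2) h
      obtain ⟨k', d', hd', hle'⟩ := hA.exists_lead_le hB hR hBA (fun j hj l c => (ih j hj l c).1) hd
      obtain ⟨rfl, rfl⟩ := hd'.unique hR h
      rcases hle with h1 | ⟨rfl, h1⟩
      · rcases hle' with h2 | ⟨h2, -⟩ <;> omega
      · rcases hle' with h2 | ⟨-, h2⟩
        · omega
        · rwa [le_antisymm h2 h1]
    exact fun l c => ⟨key hA hB hBA hAB ih l c,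
      key hB hA hAB hBA (fun j hj l c => (ih j hj l c).symm) l c⟩

/-- If the coordinate of `y A` at each pivot column of degree `l` is zero as soon as it is a
multiple of `π ^ l`, then `y A = 0`. -/
theorem vecMul_eq_zero (hA : IsRowCanonical π s Res A) (hR : IsFiniteChainRing R π q s)
    {y : Fin n → R} (h : ∀ k l c, LeadsAt π s (A k) l c → π ^ l ∣ Matrix.vecMul y A c →
      Matrix.vecMul y A c = 0) : Matrix.vecMul y A = 0 := by
  rw [Matrix.vecMul_eq_sum]
  refine Finset.sum_eq_zero fun k _ => ?_
  induction k using WellFoundedLT.induction with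
  | ind k ih =>
    rcases eq_or_ne (A k) 0 with h0 | h0
    · rw [h0, smul_zero]
    obtain ⟨l, c, hk⟩ := exists_leadsAt hR h0
    -- Terms before `k` are zero by induction and rows after `k` vanish in column `c`, so this
    -- coordinate isolates `y k`.
    have hc : Matrix.vecMul y A c = y k * π ^ l := by
      rw [Matrix.vecMul_eq_sum, Finset.sum_apply, Finset.sum_eq_single k]
      · rw [Pi.smul_apply, hA.apply_lead hR hk, smul_eq_mul]
      · intro j _ hj
        rcases lt_or_gt_of_ne hj with hj | hj
        · rw [ih j hj (Finset.mem_univ j), Pi.zero_apply]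
        · rw [Pi.smul_apply, hA.apply_below hR hk hj, smul_zero]
      · simp
    have h1 := h k l c hk (hc ▸ Dvd.intro_left _ rfl)
    funext j
    obtain ⟨b, hb⟩ := hk.dvd j
    rw [Pi.smul_apply, hb, smul_eq_mul, ← mul_assoc, ← hc, h1, zero_mul, Pi.zero_apply]

/-- Matrices in row canonical form with the same row span are equal. -/
theorem eq_of_vecMul (hA : IsRowCanonical π s Res A) (hB : IsRowCanonical π s Res B)
    (hR : IsFiniteChainRing R π q s) (hRes : IsResidueSet π Res)
    (hBA : ∀ i, ∃ y, B i = Matrix.vecMul y A) (hAB : ∀ i, ∃ y, A i = Matrix.vecMul y B) :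
    A = B := by
  have hlead := hA.leadsAt_iff hB hR hBA hAB
  funext i
  obtain ⟨y, hy⟩ := hBA i
  -- The difference of the two rows lies in the row span of `A`. At each pivot column its two
  -- entries are both zero, both the pivot, or both reduced modulo `π ^ l`, so `vecMul_eq_zero`
  -- applies.
  have hd : Matrix.vecMul (Pi.single i 1 - y) A = A i - B i := by
    rw [Matrix.sub_vecMul, ← hy, Matrix.single_one_vecMul]; rfl
  rw [← sub_eq_zero, ← hd]
  refine hA.vecMul_eq_zero hR fun k l c hk hdvd => ?_
  have hk' := (hlead k l c).1 hk
  rw [hd] at hdvd ⊢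
  rw [Pi.sub_apply] at hdvd ⊢
  rcases lt_trichotomy k i with hki | rfl | hki
  · rw [hA.apply_below hR hk hki, hB.apply_below hR hk' hki, sub_zero]
  · rw [hA.apply_lead hR hk, hB.apply_lead hR hk', sub_self]
  · rw [sub_eq_zero]
    exact hRes.eq_of_mem_residuesPow hR hk.lt.le (hA.apply_above hR hk hki)
      (hB.apply_above hR hk' hki) hdvd

theorem eq_of_unit_mul (hA : IsRowCanonical π s Res A) (hB : IsRowCanonical π s Res B)
    (hR : IsFiniteChainRing R π q s) (hRes : IsResidueSet π Res)
    (U : (Matrix (Fin n) (Fin n) R)ˣ) (hU : (U : Matrix (Fin n) (Fin n) R) * A = B) : A = B := by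
  have hU' : (↑U⁻¹ : Matrix (Fin n) (Fin n) R) * B = A := by
    rw [← hU, ← Matrix.mul_assoc, Units.inv_mul, Matrix.one_mul]
  refine hA.eq_of_vecMul hB hR hRes (fun i => ⟨(U : Matrix (Fin n) (Fin n) R) i, ?_⟩)
    (fun i => ⟨(↑U⁻¹ : Matrix (Fin n) (Fin n) R) i, ?_⟩)
  · rw [← hU]; rfl
  · nth_rewrite 1 [← hU']; rfl

/-- Coefficients taken from `ℛ(π ^ (s - l i))` give distinct combinations: once the earlier ones
agree, the pivot column of row `k` determines `y k` modulo `π ^ (s - l k)`. Rows with `l i = s`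
contribute a factor `1`. -/
theorem le_card_rowSpan (hA : IsRowCanonical π s Res A) (hR : IsFiniteChainRing R π q s)
    (hRes : IsResidueSet π Res) {l : Fin n → ℕ}
    (hl : ∀ i, l i = s ∨ ∃ c, LeadsAt π s (A i) (l i) c) :
    q ^ ∑ i, (s - l i) ≤ Nat.card (rowSpan A) := by
  have hcard : Nat.card (∀ i, residuesPow π Res (s - l i)) = q ^ ∑ i, (s - l i) := by
    rw [Nat.card_pi, Finset.prod_congr rfl fun i _ => hRes.card_residuesPow hR (Nat.sub_le s (l i)),
      Finset.prod_pow_eq_pow_sum]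
  rw [← hcard]
  let f : (∀ i, residuesPow π Res (s - l i)) → rowSpan A := fun y =>
    ⟨Matrix.vecMul (fun i => (y i : R)) A, by
      rw [Matrix.vecMul_eq_sum]
      exact Submodule.sum_mem _ fun i _ => Submodule.smul_mem _ _ (Submodule.subset_span ⟨i, rfl⟩)⟩
  refine Nat.card_le_card_of_injective f fun y y' hyy => ?_
  have hyy' : Matrix.vecMul (fun i => (y i : R)) A = Matrix.vecMul (fun i => (y' i : R)) A :=
    congrArg Subtype.val hyy
  funext k
  induction k using WellFoundedLT.induction with
  | ind k ih =>
    refine Subtype.ext (hRes.eq_of_mem_residuesPow hR (Nat.sub_le s (l k)) (y k).2 (y' k).2 ?_)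
    rcases hl k with h0 | ⟨c, hc⟩
    · simp [h0]
    have h1 : ((y k : R) - y' k) * π ^ l k = 0 := by
      have h2 : Matrix.vecMul (fun i => (y i : R) - y' i) A c = 0 := by
        rw [show (fun i => (y i : R) - y' i) = (fun i => (y i : R)) - fun i => (y' i : R) from rfl,
          Matrix.sub_vecMul, hyy', sub_self, Pi.zero_apply]
      rw [Matrix.vecMul_eq_sum, Finset.sum_apply, Finset.sum_eq_single k] at h2
      · rwa [Pi.smul_apply, hA.apply_lead hR hc, smul_eq_mul] at h2
      · intro j _ hj
        rcases lt_or_gt_of_ne hj with hj | hj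
        · rw [ih j hj, sub_self, zero_smul, Pi.zero_apply]
        · rw [Pi.smul_apply, hA.apply_below hR hc hj, smul_zero]
      · simp
    exact hR.dvd_of_pow_mul_eq_zero hc.lt.le (by rw [mul_comm]; exact h1)

end IsRowCanonical

end RowCanonical

/-! ### Combinatorics of shapes -/

section Shape

variable {s : ℕ} {μ κ : Fin s → ℕ}

/-- By monotonicity the indices with `μ i ≤ j` form an initial segment, of length `shapeExp μ j`.
This is the dictionary between exponents and positions used throughout. -/
theorem lt_shapeExp_iff (hμ : Monotone μ) (i : Fin s) (j : ℕ) :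
    (i : ℕ) < shapeExp μ j ↔ μ i ≤ j := by
  constructor
  · intro h
    by_contra hj
    have : (Finset.univ.filter fun i => μ i ≤ j) ⊆ Finset.Iio i := fun k hk => by
      rw [Finset.mem_Iio]
      by_contra hki
      exact hj ((hμ (not_lt.1 hki)).trans (Finset.mem_filter.1 hk).2)
    have := Finset.card_le_card this
    rw [Fin.card_Iio] at this
    unfold shapeExp at h
    omega
  · intro h
    have : Finset.Iic i ⊆ (Finset.univ.filter fun i => μ i ≤ j) := fun k hk => by
      simpa using (hμ (Finset.mem_Iic.1 hk)).trans h
    have := Finset.card_le_card this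
    rw [Fin.card_Iic] at this
    unfold shapeExp
    omega

theorem shapeExp_le (μ : Fin s → ℕ) (j : ℕ) : shapeExp μ j ≤ s :=
  (Finset.card_filter_le _ _).trans (by simp)

theorem shapeExp_mono (μ : Fin s → ℕ) : Monotone (shapeExp μ) := fun _ _ h =>
  Finset.card_le_card (Finset.monotone_filter_right _ fun _ _ hk => hk.trans h)

theorem shapeExp_anti (h : κ ≤ μ) (j : ℕ) : shapeExp μ j ≤ shapeExp κ j :=
  Finset.card_le_card (Finset.monotone_filter_right _ fun i _ hk => (h i).trans hk)

theorem le_len (μ : Fin s → ℕ) (i : Fin s) : μ i ≤ len μ := Finset.le_sup (Finset.mem_univ i)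

theorem shapeExp_lt_iff {j : ℕ} : shapeExp μ j < s ↔ j < len μ := by
  have h1 : shapeExp μ j < s ↔ ∃ i, ¬ μ i ≤ j := by
    rw [← not_iff_not, not_lt, not_exists]
    simp only [not_not]
    constructor
    · intro h
      have h2 : (Finset.univ.filter fun i => μ i ≤ j) = Finset.univ :=
        Finset.eq_univ_of_card _ (le_antisymm (Finset.card_le_univ _) (by simpa [shapeExp] using h))
      intro i
      have := Finset.mem_univ i
      rw [← h2] at this
      exact (Finset.mem_filter.1 this).2
    · intro h
      rw [shapeExp, Finset.filter_true_of_mem fun i _ => h i, Finset.card_univ, Fintype.card_fin]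
  rw [h1, len, Finset.lt_sup_iff]
  simp

end Shape

/-! ### Entrywise description of principal forms -/

section Principal

variable {R : Type*} [CommRing R] {π : R} {q s n : ℕ} {Res : Set R} {μ κ : Fin s → ℕ}

/-- Entrywise description of the principal row canonical forms, see `principalForms_eq`. -/
structure IsPrincipalArray (π : R) (Res : Set R) {n : ℕ} {s : ℕ} (μ κ : Fin s → ℕ)
    (X : Matrix (Fin n) (Fin (len μ)) R) : Prop where
  diag : ∀ (a : Fin n) (b : Fin (len μ)), (a : ℕ) = b → X a b = π ^ shapeExp κ a
  mem : ∀ (a : Fin n) (b : Fin (len μ)), (a : ℕ) ≠ b → X a b ∈ residuesPow π Res (shapeExp κ b)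
  dvd_row : ∀ (a : Fin n) (b : Fin (len μ)), π ^ shapeExp κ a ∣ X a b
  dvd_col : ∀ (a : Fin n) (b : Fin (len μ)), π ^ shapeExp μ b ∣ X a b

theorem IsResidueSet.zero_mem_residuesPow (hRes : IsResidueSet π Res) (l : ℕ) :
    (0 : R) ∈ residuesPow π Res l := ⟨fun _ => 0, fun _ => hRes.zero_mem, by simp⟩

theorem IsPrincipalArray.mem_matSet {X : Matrix (Fin n) (Fin (len μ)) R}
    (hX : IsPrincipalArray π Res μ κ X) : X ∈ MatSet π n μ :=
  fun a b => Ideal.mem_span_singleton.2 (hX.dvd_col a b)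

variable [Finite R]

namespace IsPrincipalArray

variable {X : Matrix (Fin n) (Fin (len μ)) R}

/-- Below the diagonal the row exponent is at least the column exponent, and the only multiple of `π
^ l` in `ℛ(π ^ l)` is `0`. -/
theorem apply_lower (hX : IsPrincipalArray π Res μ κ X) (hR : IsFiniteChainRing R π q s)
    (hRes : IsResidueSet π Res) {a : Fin n} {b : Fin (len μ)} (hab : (b : ℕ) < a) : X a b = 0 := by
  refine hRes.eq_of_mem_residuesPow hR (shapeExp_le κ b) (hX.mem a b hab.ne')
    (hRes.zero_mem_residuesPow _) ?_
  rw [sub_zero]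
  exact (pow_dvd_pow _ (shapeExp_mono κ hab.le)).trans (hX.dvd_row a b)

theorem row_eq_zero (hX : IsPrincipalArray π Res μ κ X) (hR : IsFiniteChainRing R π q s)
    {a : Fin n} (ha : shapeExp κ a = s) : X a = 0 := by
  funext b
  have := hX.dvd_row a b
  rwa [ha, hR.pow_eq_zero le_rfl, zero_dvd_iff] at this

theorem leadsAt (hX : IsPrincipalArray π Res μ κ X) (hR : IsFiniteChainRing R π q s)
    (hRes : IsResidueSet π Res) {a : Fin n} {b : Fin (len μ)} (hab : (a : ℕ) = b)
    (ha : shapeExp κ a < s) : LeadsAt π s (X a) (shapeExp κ a) b where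
  lt := ha
  unit := ⟨1, by rw [hX.diag a b hab, Units.val_one, mul_one]⟩
  dvd := hX.dvd_row a
  dvd_lt j hj := by rw [hX.apply_lower hR hRes (hab ▸ hj : (j : ℕ) < a)]; exact dvd_zero _

theorem leadsAt_iff (hX : IsPrincipalArray π Res μ κ X) (hR : IsFiniteChainRing R π q s)
    (hRes : IsResidueSet π Res) (hκμ : κ ≤ μ) {a : Fin n} {b : Fin (len μ)} {l : ℕ} :
    LeadsAt π s (X a) l b ↔ (a : ℕ) = b ∧ shapeExp κ a < s ∧ l = shapeExp κ a := by
  constructor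
  · intro h
    have ha : shapeExp κ a < s := by
      refine lt_of_le_of_ne (shapeExp_le κ a) fun h0 => h.apply_ne_zero hR ?_
      rw [hX.row_eq_zero hR h0]; rfl
    have hlen : (a : ℕ) < len μ := shapeExp_lt_iff.1 ((shapeExp_anti hκμ a).trans_lt ha)
    obtain ⟨h1, h2⟩ := h.unique hR (hX.leadsAt hR hRes (b := ⟨a, hlen⟩) rfl ha)
    exact ⟨by rw [h2], ha, h1⟩
  · rintro ⟨h1, h2, rfl⟩
    exact hX.leadsAt hR hRes h1 h2

theorem isRowCanonical (hX : IsPrincipalArray π Res μ κ X) (hR : IsFiniteChainRing R π q s)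
    (hRes : IsResidueSet π Res) (hκμ : κ ≤ μ) : IsRowCanonical π s Res X where
  zero_below i i' hi hi' := by
    by_contra hlt
    rw [not_lt] at hlt
    refine hi (hX.row_eq_zero hR (le_antisymm (shapeExp_le κ i) ?_))
    have h1 : ¬ shapeExp κ i' < s := fun h => by
      have hlen : (i' : ℕ) < len μ := shapeExp_lt_iff.1 ((shapeExp_anti hκμ i').trans_lt h)
      exact (hX.leadsAt hR hRes (b := ⟨i', hlen⟩) rfl h).apply_ne_zero hR (congrFun hi' _)
    exact (not_lt.1 h1).trans (shapeExp_mono κ hlt)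
  order_same i i' c c' h h' _ hc := by
    rw [isPivot_iff hR, hX.leadsAt_iff hR hRes hκμ] at h h'
    rw [Fin.lt_def] at hc ⊢
    omega
  order_diff i i' c c' h h' hlt := by
    rw [isPivot_iff hR, hX.leadsAt_iff hR hRes hκμ] at h h'
    rw [h.2.2, h'.2.2] at hlt
    exact Fin.lt_def.2 ((shapeExp_mono κ).reflect_lt hlt)
  pivot_form i c h := by
    rw [isPivot_iff hR, hX.leadsAt_iff hR hRes hκμ] at h
    exact ⟨_, h.2.1, hX.diag i c h.1⟩
  below_pivot i c h i' hi := by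
    rw [isPivot_iff hR, hX.leadsAt_iff hR hRes hκμ] at h
    refine hX.apply_lower hR hRes ?_
    rw [Fin.lt_def] at hi
    omega
  above_pivot i c h l hl hli i' hi := by
    rw [isPivot_iff hR, hX.leadsAt_iff hR hRes hκμ] at h
    have h1 : l = shapeExp κ c := by
      have h2 := h.2.2
      rw [hli, hR.deg_pow hl] at h2
      rw [h2, h.1]
    rw [h1]
    refine hX.mem i' c ?_
    rw [Fin.lt_def] at hi
    omega

/-- Quotients by powers of `π` are not unique, so the values `1` on the diagonal and `0` below it
are chosen explicitly, also for zero rows. -/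
theorem exists_triangular (hX : IsPrincipalArray π Res μ κ X) (hR : IsFiniteChainRing R π q s)
    (hRes : IsResidueSet π Res) : ∃ T : Matrix (Fin n) (Fin (len μ)) R,
      (∀ a b, X a b = π ^ shapeExp κ a * T a b) ∧
      (∀ (a : Fin n) (b : Fin (len μ)), (a : ℕ) = b → T a b = 1) ∧
      ∀ (a : Fin n) (b : Fin (len μ)), (b : ℕ) < a → T a b = 0 := by
  have h : ∀ (a : Fin n) (b : Fin (len μ)), ∃ t, X a b = π ^ shapeExp κ a * t ∧
      ((a : ℕ) = b → t = 1) ∧ ((b : ℕ) < a → t = 0) := fun a b => by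
    rcases lt_trichotomy (a : ℕ) b with hab | hab | hab
    · obtain ⟨t, ht⟩ := hX.dvd_row a b
      exact ⟨t, ht, fun h => by omega, fun h => by omega⟩
    · exact ⟨1, by rw [hX.diag a b hab, mul_one], fun _ => rfl, fun h => by omega⟩
    · exact ⟨0, by rw [hX.apply_lower hR hRes hab, mul_zero], fun h => by omega, fun _ => rfl⟩
  choose T hT using h
  exact ⟨T, fun a b => (hT a b).1, fun a b => (hT a b).2.1, fun a b => (hT a b).2.2⟩

/-- Write `X` as a diagonal matrix of powers of `π` times a unitriangular `T`. Multiplication by the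
first `len κ` rows of `T` is injective and carries `R^κ` onto the row span. -/
theorem hasShape (hX : IsPrincipalArray π Res μ κ X) (hR : IsFiniteChainRing R π q s)
    (hRes : IsResidueSet π Res) (hκμ : κ ≤ μ) (hκn : ∀ i, κ i ≤ n) : HasShape π X κ := by
  obtain ⟨T, hT, hT1, hT0⟩ := hX.exists_triangular hR hRes
  have hrn : len κ ≤ n := Finset.sup_le fun i _ => hκn i
  have hrm : len κ ≤ len μ := Finset.sup_mono_fun fun i _ => hκμ i
  let T' : Matrix (Fin (len κ)) (Fin (len μ)) R := fun j => T (Fin.castLE hrn j)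
  let L : (Fin (len κ) → R) →ₗ[R] (Fin (len μ) → R) := Matrix.vecMulLinear T'
  have hL : ∀ y, L y = ∑ j, y j • T (Fin.castLE hrn j) := fun y => Matrix.vecMul_eq_sum y T'
  have hinj : Function.Injective L := by
    rw [injective_iff_map_eq_zero]
    intro y hy
    funext j
    induction j using WellFoundedLT.induction with
    | ind j ih =>
      have h1 := congrFun hy (Fin.castLE hrm j)
      rw [hL, Finset.sum_apply, Finset.sum_eq_single j] at h1
      · rwa [Pi.smul_apply, hT1 _ _ (by simp), smul_eq_mul, mul_one] at h1
      · intro k _ hk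
        rcases lt_or_gt_of_ne hk with hk | hk
        · rw [ih k hk, Pi.zero_apply, zero_smul, Pi.zero_apply]
        · rw [Pi.smul_apply, hT0 _ _ (by simpa using hk), smul_zero]
      · simp
  have hspan : rowSpan X = (shapeModule π κ).map L := by
    apply le_antisymm
    · refine Submodule.span_le.2 ?_
      rintro _ ⟨i, rfl⟩
      by_cases hi : (i : ℕ) < len κ
      · refine ⟨Pi.single ⟨i, hi⟩ (π ^ shapeExp κ i), fun j => ?_, ?_⟩
        · rcases eq_or_ne j ⟨i, hi⟩ with rfl | hj
          · rw [Pi.single_eq_same]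
            exact Ideal.mem_span_singleton_self _
          · rw [Pi.single_eq_of_ne hj]
            exact Ideal.zero_mem _
        · rw [hL, Finset.sum_eq_single ⟨i, hi⟩]
          · funext b
            rw [Pi.single_eq_same]
            exact (hT i b).symm
          · intro k _ hk
            rw [Pi.single_eq_of_ne hk, zero_smul]
          · simp
      · show X i ∈ _
        rw [hX.row_eq_zero hR (le_antisymm (shapeExp_le κ i)
          (not_lt.1 fun h => hi (shapeExp_lt_iff.1 h)))]
        exact Submodule.zero_mem _
    · rintro _ ⟨y, hy, rfl⟩
      rw [hL]
      refine Submodule.sum_mem _ fun j _ => ?_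
      obtain ⟨z, hz⟩ := Ideal.mem_span_singleton.1 (hy j)
      have : y j • T (Fin.castLE hrn j) = z • X (Fin.castLE hrn j) := by
        funext b
        rw [Pi.smul_apply, Pi.smul_apply, hT, hz, smul_eq_mul, smul_eq_mul, Fin.val_castLE]
        ring
      rw [this]
      exact Submodule.smul_mem _ _ (Submodule.subset_span ⟨_, rfl⟩)
  exact ⟨(LinearEquiv.ofEq _ _ hspan).trans (Submodule.equivMapOfInjective L hinj _).symm⟩

end IsPrincipalArray

/-- An element `π ^ e * z` depends only on `z` modulo `π ^ (s - e)`. The exponent is a sum over all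
`n` rows so that it can be compared with `IsRowCanonical.le_card_rowSpan`; indices beyond `len κ`
add `0`. -/
theorem card_shapeModule_le (hR : IsFiniteChainRing R π q s) (hRes : IsResidueSet π Res)
    (hκn : ∀ i, κ i ≤ n) :
    Nat.card (shapeModule π κ) ≤ q ^ ∑ i : Fin n, (s - shapeExp κ i) := by
  have hcard : Nat.card (∀ i : Fin n, residuesPow π Res (s - shapeExp κ i)) =
      q ^ ∑ i : Fin n, (s - shapeExp κ i) := by
    rw [Nat.card_pi, Finset.prod_congr rfl fun i _ => hRes.card_residuesPow hR (Nat.sub_le s _),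
      Finset.prod_pow_eq_pow_sum]
  have hrn : len κ ≤ n := Finset.sup_le fun i _ => hκn i
  rw [← hcard]
  let f : (∀ i : Fin n, residuesPow π Res (s - shapeExp κ i)) → shapeModule π κ := fun z =>
    ⟨fun j => π ^ shapeExp κ j * z (Fin.castLE hrn j),
      fun j => Ideal.mem_span_singleton.2 (Dvd.intro _ rfl)⟩
  refine Nat.card_le_card_of_surjective f ?_
  rintro ⟨x, hx⟩
  have h : ∀ i : Fin n, ∃ z : residuesPow π Res (s - shapeExp κ i), ∀ h : (i : ℕ) < len κ,
      x ⟨i, h⟩ = π ^ shapeExp κ i * z := by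
    intro i
    by_cases hi : (i : ℕ) < len κ
    · obtain ⟨y, hy⟩ := Ideal.mem_span_singleton.1 (hx ⟨i, hi⟩)
      obtain ⟨z, hz, t, ht⟩ := hRes.exists_mem_residuesPow y (s - shapeExp κ i)
      refine ⟨⟨z, hz⟩, fun _ => ?_⟩
      have h1 : π ^ shapeExp κ i * (y - z) = 0 := by
        rw [ht, ← mul_assoc, ← pow_add, hR.pow_eq_zero (by have := shapeExp_le κ i; omega),
          zero_mul]
      rw [hy]
      linear_combination h1
    · exact ⟨⟨0, hRes.zero_mem_residuesPow _⟩, fun h => absurd h hi⟩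
  choose z hz using h
  refine ⟨z, Subtype.ext (funext fun j => ?_)⟩
  exact (hz (Fin.castLE hrn j) j.2).symm

/-- The diagonal bounds each row degree `l i` above by `shapeExp κ i`. The size of the row span,
fixed by the shape, gives the reverse inequality for the sums, so all degrees are equal to their
bounds. -/
theorem isPrincipalArray_of_mem (hR : IsFiniteChainRing R π q s) (hRes : IsResidueSet π Res)
    (hκμ : κ ≤ μ) (hκn : ∀ i, κ i ≤ n) {X : Matrix (Fin n) (Fin (len μ)) R}
    (hX : X ∈ principalForms π Res n μ κ) : IsPrincipalArray π Res μ κ X := by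
  obtain ⟨hmat, ⟨φ⟩, hcan, hdiag⟩ := hX
  have hlead : ∀ i, ∃ l, (X i = 0 ∧ l = s) ∨ ∃ c, LeadsAt π s (X i) l c := fun i => by
    rcases eq_or_ne (X i) 0 with h0 | h0
    · exact ⟨s, Or.inl ⟨h0, rfl⟩⟩
    · obtain ⟨l, c, h⟩ := exists_leadsAt hR h0
      exact ⟨l, Or.inr ⟨c, h⟩⟩
  choose l hl using hlead
  have hls : ∀ i, l i ≤ s := fun i => by
    rcases hl i with h | ⟨c, h⟩
    exacts [h.2.le, h.lt.le]
  have hdvd : ∀ i j, π ^ l i ∣ X i j := fun i j => by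
    rcases hl i with h | ⟨c, h⟩
    · rw [h.1]; exact dvd_zero _
    · exact h.dvd j
  have hlen : ∀ {i : ℕ}, shapeExp κ i < s → i < len μ := fun {i} h =>
    shapeExp_lt_iff.1 ((shapeExp_anti hκμ i).trans_lt h)
  have hle : ∀ i : Fin n, l i ≤ shapeExp κ i := fun i => by
    rcases lt_or_eq_of_le (shapeExp_le κ i) with h | h
    · by_contra hlt
      have := hdvd i ⟨i, hlen h⟩
      rw [hdiag i ⟨i, hlen h⟩ rfl] at this
      exact hR.not_pow_dvd_pow (not_le.1 hlt) h this
    · rw [h]; exact hls i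
  have hsum : ∑ i, (s - l i) ≤ ∑ i : Fin n, (s - shapeExp κ i) := by
    have h1 := hcan.le_card_rowSpan hR hRes (l := l) fun i => by
      rcases hl i with h | h
      exacts [Or.inl h.2, Or.inr h]
    rw [Nat.card_congr φ.toEquiv] at h1
    exact (Nat.pow_le_pow_iff_right hR.one_lt).1 (h1.trans (card_shapeModule_le hR hRes hκn))
  have heq : ∀ i : Fin n, l i = shapeExp κ i := fun i => by
    have h1 : ∀ i ∈ Finset.univ, s - shapeExp κ (i : Fin n) ≤ s - l i := fun i _ => by
      have := hle i; omega
    have h2 := (Finset.sum_eq_sum_iff_of_le h1).1 (le_antisymm (Finset.sum_le_sum h1) hsum) i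
      (Finset.mem_univ i)
    have := hls i; have := shapeExp_le κ i
    omega
  -- A pivot left of the diagonal would lie below an earlier pivot, where entries vanish; one right
  -- of it would come after a diagonal entry of the same degree.
  have hpiv : ∀ (k : ℕ) (hk : k < n) (hks : shapeExp κ k < s),
      LeadsAt π s (X ⟨k, hk⟩) (shapeExp κ k) ⟨k, hlen hks⟩ := by
    intro k
    induction k using Nat.strong_induction_on with
    | _ k ih =>
      intro hk hks
      have hd := hdiag ⟨k, hk⟩ ⟨k, hlen hks⟩ rfl
      rcases hl ⟨k, hk⟩ with h | ⟨c, h⟩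
      · rw [h.1, Pi.zero_apply] at hd
        exact absurd hd.symm (hR.pow_ne_zero hks)
      rw [heq] at h
      rcases lt_trichotomy (c : ℕ) k with hc | hc | hc
      · have h1 := ih c hc (by omega) ((shapeExp_mono κ hc.le).trans_lt hks)
        exact absurd (hcan.apply_below hR h1 (i' := ⟨k, hk⟩) hc) (h.apply_ne_zero hR)
      · have : c = ⟨k, hlen hks⟩ := Fin.ext hc
        rwa [← this]
      · have h1 := h.dvd_lt ⟨k, hlen hks⟩ hc
        rw [hd] at h1
        exact absurd h1 (hR.not_pow_dvd_pow (Nat.lt_succ_self _) hks)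
  refine ⟨hdiag, fun a b hab => ?_, fun a b => heq a ▸ hdvd a b,
    fun a b => Ideal.mem_span_singleton.1 (hmat a b)⟩
  rcases lt_or_eq_of_le (shapeExp_le κ b) with h | h
  · have hbn : (b : ℕ) < n := (shapeExp_lt_iff.1 h).trans_le (Finset.sup_le fun i _ => hκn i)
    have hb := hpiv b hbn h
    rcases lt_or_gt_of_ne hab with hab | hab
    · exact hcan.apply_above hR hb (i' := a) hab
    · rw [hcan.apply_below hR hb (i' := a) hab]
      exact hRes.zero_mem_residuesPow _
  · rw [h]
    exact hRes.mem_residuesPow_top hR _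

theorem principalForms_eq (hR : IsFiniteChainRing R π q s) (hRes : IsResidueSet π Res)
    (hκμ : κ ≤ μ) (hκn : ∀ i, κ i ≤ n) :
    principalForms π Res n μ κ = {X | IsPrincipalArray π Res μ κ X} :=
  Set.Subset.antisymm (fun _ hX => isPrincipalArray_of_mem hR hRes hκμ hκn hX) fun _ hX =>
    ⟨hX.mem_matSet, hX.hasShape hR hRes hκμ hκn, hX.isRowCanonical hR hRes hκμ, hX.diag⟩

end Principal

/-! ### The encoder and the rate -/

section Encode

variable {R : Type*} [CommRing R] {π : R} {q s n : ℕ} {Res : Set R} {μ κ : Fin s → ℕ}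

/-- The `i`-th digit of the off-diagonal entry `(a, b)` of the encoded message `u`. -/
def encodeDigit (u : MsgIdx μ κ → Res) (a b i : ℕ) : R :=
  if h : ∃ hi : i < s, a < κ ⟨i, hi⟩ ∧ κ ⟨i, hi⟩ ≤ b ∧ b < μ ⟨i, hi⟩ then
    u ⟨⟨i, h.1⟩, ⟨a, h.2.1⟩, ⟨b - κ ⟨i, h.1⟩, by have := h.2; omega⟩⟩
  else 0

theorem encodeDigit_mem (hRes : IsResidueSet π Res) (u : MsgIdx μ κ → Res) (a b i : ℕ) :
    encodeDigit u a b i ∈ Res := by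
  unfold encodeDigit
  split_ifs
  exacts [Subtype.coe_prop _, hRes.zero_mem]

/-- Through `lt_shapeExp_iff`, the conditions `a < κ_i`, `b < μ_i` and `κ_i ≤ b` become the row,
column and residue constraints of `IsPrincipalArray`. -/
theorem encodeDigit_ne_zero (hμ : Monotone μ) (hκ : Monotone κ) {u : MsgIdx μ κ → Res} {a b i : ℕ}
    (h : encodeDigit u a b i ≠ 0) : shapeExp κ a ≤ i ∧ shapeExp μ b ≤ i ∧ i < shapeExp κ b := by
  unfold encodeDigit at h
  split_ifs at h with h'
  · obtain ⟨hi, h1, h2, h3⟩ := h'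
    have e1 := lt_shapeExp_iff hκ ⟨i, hi⟩ a
    have e2 := lt_shapeExp_iff hμ ⟨i, hi⟩ b
    have e3 := lt_shapeExp_iff hκ ⟨i, hi⟩ b
    simp only at e1 e2 e3
    omega
  · exact absurd rfl h

theorem encodeDigit_eq (u : MsgIdx μ κ → Res) (i : Fin s) (a : Fin (κ i)) (b : Fin (μ i - κ i)) :
    encodeDigit u a (κ i + b) i = u ⟨i, a, b⟩ := by
  have h : ∃ hi : (i : ℕ) < s, (a : ℕ) < κ ⟨i, hi⟩ ∧ κ ⟨i, hi⟩ ≤ κ i + b ∧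
      κ i + (b : ℕ) < μ ⟨i, hi⟩ :=
    ⟨i.2, a.2, Nat.le_add_right _ _, by have := b.2; simp only [Fin.eta]; omega⟩
  rw [encodeDigit, dif_pos h]
  congr 3
  simp

theorem encode_apply_of_ne (u : MsgIdx μ κ → Res) {a : Fin n} {b : Fin (len μ)}
    (hab : (a : ℕ) ≠ b) :
    encode π n μ κ u a b = ∑ i ∈ Finset.range s, encodeDigit u a b i * π ^ i := by
  rw [Finset.sum_range, encode, Matrix.sum_apply]
  refine Finset.sum_congr rfl fun i _ => ?_
  rw [Matrix.smul_apply, smul_eq_mul, mul_comm]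
  congr 1
  unfold auxMatrix encodeDigit
  by_cases h : ∃ hi : (i : ℕ) < s, (a : ℕ) < κ ⟨i, hi⟩ ∧ κ ⟨i, hi⟩ ≤ b ∧ (b : ℕ) < μ ⟨i, hi⟩
  · rw [dif_pos h, dif_pos h.2.1, dif_pos h.2.2]
  · rw [dif_neg h]
    split_ifs with h1 h2 h3
    · exact absurd ⟨i.2, h1, h2⟩ h
    · exact absurd h3.1 hab
    · rfl
    · rfl

variable [Finite R]

/-- Only the first `i` with `a < κ i` puts a `1` at this position, and its index is `shapeExp κ a`.
If there is none, the entry is `0 = π ^ s`. -/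
theorem encode_apply_of_eq (hR : IsFiniteChainRing R π q s) (hκ : Monotone κ)
    (u : MsgIdx μ κ → Res) {a : Fin n} {b : Fin (len μ)} (hab : (a : ℕ) = b) :
    encode π n μ κ u a b = π ^ shapeExp κ a := by
  have haux : ∀ i : Fin s, auxMatrix n μ κ u i a b = if (i : ℕ) = shapeExp κ a then 1 else 0 := by
    intro i
    have e1 := lt_shapeExp_iff hκ i a
    unfold auxMatrix
    by_cases h1 : (a : ℕ) < κ i
    · rw [dif_pos h1, dif_neg (by omega)]
      refine if_congr ?_ rfl rfl
      constructor
      · rintro ⟨-, h2⟩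
        by_contra hne
        have hlt : shapeExp κ a < i := by omega
        have h3 := h2 ⟨shapeExp κ a, hlt.trans i.2⟩ (Fin.lt_def.2 hlt)
        rw [← lt_shapeExp_iff hκ] at h3
        exact lt_irrefl _ h3
      · intro h
        exact ⟨hab, fun i' hi' => (lt_shapeExp_iff hκ i' a).1 (by rw [Fin.lt_def] at hi'; omega)⟩
    · rw [dif_neg h1, if_neg (by omega)]
  rw [encode, Matrix.sum_apply]
  simp only [Matrix.smul_apply, haux, smul_eq_mul, mul_ite, mul_one, mul_zero]
  rcases lt_or_eq_of_le (shapeExp_le κ a) with h | h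
  · rw [Finset.sum_eq_single ⟨shapeExp κ a, h⟩]
    · simp
    · intro i _ hi
      rw [if_neg fun h => hi (Fin.ext h)]
    · simp
  · rw [h, hR.pow_eq_zero le_rfl]
    exact Finset.sum_eq_zero fun i _ => if_neg i.2.ne

theorem isPrincipalArray_encode (hR : IsFiniteChainRing R π q s) (hRes : IsResidueSet π Res)
    (hμ : Monotone μ) (hκ : Monotone κ) (hκμ : κ ≤ μ) (u : MsgIdx μ κ → Res) :
    IsPrincipalArray π Res μ κ (encode π n μ κ u) := by
  have hdvd : ∀ (a : Fin n) (b : Fin (len μ)), π ^ shapeExp κ a ∣ encode π n μ κ u a b ∧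
      π ^ shapeExp μ b ∣ encode π n μ κ u a b := by
    intro a b
    by_cases hab : (a : ℕ) = b
    · rw [encode_apply_of_eq hR hκ u hab, ← hab]
      exact ⟨dvd_rfl, pow_dvd_pow _ (shapeExp_anti hκμ a)⟩
    · rw [encode_apply_of_ne u hab]
      refine ⟨Finset.dvd_sum fun i _ => ?_, Finset.dvd_sum fun i _ => ?_⟩ <;>
      · rcases eq_or_ne (encodeDigit u a b i) 0 with h0 | h0
        · rw [h0, zero_mul]; exact dvd_zero _
        · have := encodeDigit_ne_zero hμ hκ h0
          exact Dvd.dvd.mul_left (pow_dvd_pow _ (by omega)) _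
  refine ⟨fun a b hab => encode_apply_of_eq hR hκ u hab, fun a b hab => ?_,
    fun a b => (hdvd a b).1, fun a b => (hdvd a b).2⟩
  refine ⟨encodeDigit u a b, encodeDigit_mem hRes u a b, ?_⟩
  rw [encode_apply_of_ne u hab]
  symm
  refine Finset.sum_subset (Finset.range_mono (shapeExp_le κ b)) fun i _ hi => ?_
  have : encodeDigit u a b i = 0 := by
    by_contra h0
    exact hi (Finset.mem_range.2 (encodeDigit_ne_zero hμ hκ h0).2.2)
  rw [this, zero_mul]

theorem encode_injective (hR : IsFiniteChainRing R π q s) (hRes : IsResidueSet π Res)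
    (hκn : ∀ i, κ i ≤ n) : Function.Injective (encode (Res := Res) π n μ κ) := by
  intro u u' h
  funext ⟨i, a, b⟩
  have ha := (a.2.trans_le (hκn i))
  have hb : κ i + (b : ℕ) < len μ := lt_of_lt_of_le (by have := b.2; omega) (le_len μ i)
  have hne : ((⟨a, ha⟩ : Fin n) : ℕ) ≠ (⟨κ i + b, hb⟩ : Fin (len μ)) := by
    have := a.2
    simp only
    omega
  have h1 := congrFun (congrFun h ⟨a, ha⟩) ⟨κ i + b, hb⟩
  rw [encode_apply_of_ne u hne, encode_apply_of_ne u' hne] at h1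
  have h2 := hRes.digits_unique hR le_rfl (encodeDigit_mem hRes u a (κ i + b))
    (encodeDigit_mem hRes u' a (κ i + b)) (by rw [h1, sub_self]; exact dvd_zero _) i i.2
  rw [encodeDigit_eq, encodeDigit_eq] at h2
  exact Subtype.ext h2

theorem IsPrincipalArray.exists_encode {X : Matrix (Fin n) (Fin (len μ)) R}
    (hX : IsPrincipalArray π Res μ κ X) (hR : IsFiniteChainRing R π q s)
    (hRes : IsResidueSet π Res) (hμ : Monotone μ) (hκ : Monotone κ)
    (hκn : ∀ i, κ i ≤ n) : ∃ u : MsgIdx μ κ → Res, encode π n μ κ u = X := by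
  -- On the diagonal the requirement is vacuous, which permits one choice of digits for all entries.
  have h : ∀ (a : Fin n) (b : Fin (len μ)), ∃ d : ℕ → R, (a : ℕ) ≠ b → (∀ i, d i ∈ Res) ∧
      (∀ i, d i ≠ 0 → max (shapeExp κ a) (shapeExp μ b) ≤ i ∧ i < shapeExp κ b) ∧
      X a b = ∑ i ∈ Finset.range s, d i * π ^ i := by
    intro a b
    by_cases hab : (a : ℕ) = b
    · exact ⟨fun _ => 0, fun h => absurd hab h⟩
    · obtain ⟨d, hd⟩ := hRes.exists_digits_of_dvd hR
        (max_le (shapeExp_le κ a) (shapeExp_le μ b)) (shapeExp_le κ b) (hX.mem a b hab) (by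
          rcases max_choice (shapeExp κ a) (shapeExp μ b) with h | h <;> rw [h]
          exacts [hX.dvd_row a b, hX.dvd_col a b])
      exact ⟨d, fun _ => hd⟩
  choose d hd using h
  have ha : ∀ (i : Fin s) (a : Fin (κ i)), (a : ℕ) < n := fun i a => a.2.trans_le (hκn i)
  have hb : ∀ (i : Fin s) (b : Fin (μ i - κ i)), κ i + (b : ℕ) < len μ := fun i b =>
    lt_of_lt_of_le (by have := b.2; omega) (le_len μ i)
  refine ⟨fun x => ⟨d ⟨x.2.1, ha _ x.2.1⟩ ⟨κ x.1 + x.2.2, hb _ x.2.2⟩ x.1,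
    (hd _ _ (by have := x.2.1.2; simp only; omega)).1 _⟩, ?_⟩
  funext a b
  by_cases hab : (a : ℕ) = b
  · rw [encode_apply_of_eq hR hκ _ hab, hX.diag a b hab]
  rw [encode_apply_of_ne _ hab, (hd a b hab).2.2]
  refine Finset.sum_congr rfl fun i hi => ?_
  congr 1
  unfold encodeDigit
  split_ifs with h
  · have h2 := h.2.2.1
    have : (⟨κ ⟨i, h.1⟩ + (b - κ ⟨i, h.1⟩), by have := b.2; omega⟩ : Fin (len μ)) = b :=
      Fin.ext (by simp only; omega)
    simp only [this, Fin.eta]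
  · by_contra h0
    have h1 := (hd a b hab).2.1 i (Ne.symm h0)
    have his := Finset.mem_range.1 hi
    have e1 := lt_shapeExp_iff hκ ⟨i, his⟩ a
    have e2 := lt_shapeExp_iff hμ ⟨i, his⟩ b
    have e3 := lt_shapeExp_iff hκ ⟨i, his⟩ b
    simp only at e1 e2 e3
    exact h ⟨his, by omega, by omega, by omega⟩

theorem bijOn_encode (hR : IsFiniteChainRing R π q s) (hRes : IsResidueSet π Res)
    (hμ : Monotone μ) (hκ : Monotone κ) (hκμ : κ ≤ μ) (hκn : ∀ i, κ i ≤ n) :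
    Set.BijOn (encode (Res := Res) π n μ κ) Set.univ (principalForms π Res n μ κ) := by
  rw [principalForms_eq hR hRes hκμ hκn]
  exact ⟨fun u _ => isPrincipalArray_encode hR hRes hμ hκ hκμ u,
    (encode_injective hR hRes hκn).injOn, fun _ hX => by
      obtain ⟨u, hu⟩ := IsPrincipalArray.exists_encode hX hR hRes hμ hκ hκn
      exact ⟨u, Set.mem_univ _, hu⟩⟩

theorem card_msgIdx (μ κ : Fin s → ℕ) : Nat.card (MsgIdx μ κ) = ∑ i, κ i * (μ i - κ i) := by
  simp [MsgIdx, Nat.card_eq_fintype_card]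

theorem kappa_mono (n : ℕ) (hμ : Monotone μ) : Monotone (kappa n μ) := fun _ _ h =>
  min_le_min le_rfl (Nat.div_le_div_right (hμ h))

theorem kappa_le_left (n : ℕ) (μ : Fin s → ℕ) (i : Fin s) : kappa n μ i ≤ n := min_le_left _ _

theorem kappa_le (n : ℕ) (μ : Fin s → ℕ) : kappa n μ ≤ μ := fun _ =>
  (min_le_right _ _).trans (Nat.div_le_self _ _)

theorem ncard_principalForms (hR : IsFiniteChainRing R π q s) (hRes : IsResidueSet π Res)
    (hμ : Monotone μ) (n : ℕ) : (principalForms π Res n μ (kappa n μ)).ncard =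
      q ^ ∑ i, kappa n μ i * (μ i - kappa n μ i) := by
  have h := bijOn_encode (n := n) hR hRes hμ (kappa_mono n hμ) (kappa_le n μ) (kappa_le_left n μ)
  rw [← h.image_eq, h.injOn.ncard_image, Set.ncard_univ, Nat.card_fun, card_msgIdx,
    hRes.card hR]

theorem rate_eq (hR : IsFiniteChainRing R π q s) (hRes : IsResidueSet π Res)
    (hμ : Monotone μ) (n : ℕ) : rate π Res q n μ =
      ∑ i, (kappa n μ i : ℝ) * ((μ i : ℝ) - (kappa n μ i : ℝ)) := by
  have hq : (1 : ℝ) < q := by exact_mod_cast hR.one_lt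
  rw [rate, ncard_principalForms hR hRes hμ, Nat.cast_pow, Real.logb_pow, Real.logb_self_eq_one hq,
    mul_one, Nat.cast_sum]
  refine Finset.sum_congr rfl fun i _ => ?_
  rw [Nat.cast_mul, Nat.cast_sub (kappa_le n μ i)]

end Encode

/-! ### Full column rank, zero-error decoding and transition probabilities -/

section FullRank

variable {R : Type*} [CommRing R] {π : R} {q s n N m : ℕ} {Res : Set R}

theorem len_const (hs : 0 < s) (n : ℕ) : len (fun _ : Fin s => n) = n :=
  have : Nonempty (Fin s) := ⟨⟨0, hs⟩⟩
  Finset.sup_const Finset.univ_nonempty n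

theorem shapeModule_const (π : R) (s n : ℕ) : shapeModule π (fun _ : Fin s => n) = ⊤ := by
  refine eq_top_iff.2 fun x _ j => ?_
  have hj : (j : ℕ) < n := j.2.trans_le (Finset.sup_le fun _ _ => le_rfl)
  have : shapeExp (fun _ : Fin s => n) j = 0 := by
    rw [shapeExp, Finset.filter_false_of_mem fun _ _ => by omega, Finset.card_empty]
  rw [this, pow_zero, Ideal.span_singleton_one]
  exact Submodule.mem_top

theorem rowSpan_transpose (A : Matrix (Fin N) (Fin n) R) :
    rowSpan A.transpose = LinearMap.range A.mulVecLin := (Matrix.range_mulVecLin A).symm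

/-- The elements of the shape module of `(n, …, n)` are the vectors of length `n`. -/
def shapeModuleConstEquiv (π : R) (hs : 0 < s) (n : ℕ) :
    (Fin n → R) ≃ₗ[R] shapeModule π (fun _ : Fin s => n) :=
  (LinearEquiv.funCongrLeft R R (finCongr (len_const hs n))).trans
    (Submodule.topEquiv.symm.trans (LinearEquiv.ofEq _ _ (shapeModule_const π s n).symm))

/-- The row span of the transpose is the range of `A`. If it is isomorphic to `R^n`, then it has as
many elements, and by finiteness the surjection from `R^n` onto it is injective. -/
theorem isFullColRank_iff [Finite R] (hs : 0 < s) (A : Matrix (Fin N) (Fin n) R) :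
    IsFullColRank π s A ↔ Function.Injective A.mulVec := by
  unfold IsFullColRank HasShape
  rw [rowSpan_transpose]
  constructor
  · rintro ⟨φ⟩
    have hcard : Nat.card (Fin n → R) = Nat.card (LinearMap.range A.mulVecLin) :=
      Nat.card_congr ((shapeModuleConstEquiv π hs n).trans φ.symm).toEquiv
    have hsurj : Function.Surjective A.mulVecLin.rangeRestrict :=
      LinearMap.surjective_rangeRestrict _
    have hbij := (Nat.bijective_iff_surjective_and_card _).2 ⟨hsurj, hcard⟩
    intro v w hvw
    exact hbij.1 (Subtype.ext hvw)
  · intro h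
    exact ⟨(LinearEquiv.ofInjective A.mulVecLin h).symm.trans (shapeModuleConstEquiv π hs n)⟩

theorem exists_fin_equiv_sum {ι : Type*} (hnN : n ≤ N) (hι : Nonempty (Fin n ⊕ ι ≃ Fin N)) :
    ∃ e : Fin n ⊕ ι ≃ Fin N, ∀ i, e (Sum.inl i) = Fin.castLE hnN i := by
  obtain ⟨f⟩ := hι
  have : Finite (Fin n ⊕ ι) := Finite.of_equiv _ f.symm
  have : Finite ι := Finite.of_injective (Sum.inr : ι → Fin n ⊕ ι) Sum.inr_injective
  have hcard : Nat.card ι = N - n := by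
    have := Nat.card_congr f
    rw [Nat.card_sum, Nat.card_fin, Nat.card_fin] at this
    omega
  let g : ι ≃ Fin (N - n) := Finite.equivFinOfCardEq hcard
  refine ⟨((Equiv.sumCongr (Equiv.refl _) g).trans finSumFinEquiv).trans (finCongr (by omega)),
    fun i => Fin.ext (by simp)⟩

theorem basis_sumExtend_inl {ι K V : Type*} [Field K] [AddCommGroup V] [Module K V] {v : ι → V}
    (hv : LinearIndependent K v) (i : ι) : Module.Basis.sumExtend hv (Sum.inl i) = v i := by
  simp only [Module.Basis.sumExtend, Module.Basis.reindex_apply, Module.Basis.extend_apply_self]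
  rfl

/-- A matrix with injective action over a chain ring extends to an invertible matrix. -/
theorem exists_unit_extension [Finite R] (hR : IsFiniteChainRing R π q s) (hnN : n ≤ N)
    {A : Matrix (Fin N) (Fin n) R} (hA : Function.Injective A.mulVec) :
    ∃ P : (Matrix (Fin N) (Fin N) R)ˣ,
      ∀ i j, (P : Matrix (Fin N) (Fin N) R) i (Fin.castLE hnN j) = A i j := by
  have := hR.maximal
  let _ : Field (R ⧸ Ideal.span {π}) := Ideal.Quotient.field _
  let φ : R →+* R ⧸ Ideal.span {π} := Ideal.Quotient.mk _
  have hφ : ∀ x, φ x = 0 ↔ π ∣ x := fun x => by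
    rw [Ideal.Quotient.eq_zero_iff_mem, Ideal.mem_span_singleton]
  have hs := hR.pos
  -- If `A w` vanishes modulo `π`, then `A` kills `π ^ (s - 1) w`; so this vector is zero and `π`
  -- divides `w`.
  have hinj : Function.Injective (A.map φ).mulVec := by
    refine (injective_iff_map_eq_zero (A.map φ).mulVecLin).2 fun v hv => ?_
    choose w hw using fun j => Ideal.Quotient.mk_surjective (v j)
    have hv' : ∀ i, π ∣ A.mulVec w i := fun i => by
      rw [← hφ]
      have := congrFun hv i
      simp only [Matrix.mulVecLin_apply, Matrix.mulVec, dotProduct, Matrix.map_apply,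
        Pi.zero_apply] at this ⊢
      rw [map_sum, ← this]
      exact Finset.sum_congr rfl fun j _ => by rw [map_mul, ← hw j]
    have h0 : A.mulVec (π ^ (s - 1) • w) = A.mulVec 0 := by
      rw [Matrix.mulVec_smul, Matrix.mulVec_zero]
      funext i
      obtain ⟨c, hc⟩ := hv' i
      rw [Pi.smul_apply, hc, smul_eq_mul, ← mul_assoc, ← pow_succ, hR.pow_eq_zero (by omega),
        zero_mul, Pi.zero_apply]
    funext j
    have h1 := hR.dvd_of_pow_mul_eq_zero (Nat.sub_le s 1) (congrFun (hA h0) j)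
    rw [show s - (s - 1) = 1 by omega, pow_one] at h1
    rw [← hw j]
    exact (hφ _).2 h1
  have hli : LinearIndependent (R ⧸ Ideal.span {π}) (A.map φ).col :=
    Matrix.mulVec_injective_iff.1 hinj
  -- The reduced columns are completed to a basis over the residue field. The new columns are lifted
  -- to `R`, and a determinant that is nonzero modulo `π` is a unit.
  let b := Module.Basis.sumExtend hli
  obtain ⟨e, he⟩ := exists_fin_equiv_sum hnN
    ⟨b.indexEquiv (Pi.basisFun (R ⧸ Ideal.span {π}) (Fin N))⟩
  choose lift hlift using fun i k => Ideal.Quotient.mk_surjective (b (e.symm k) i)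
  let P : Matrix (Fin N) (Fin N) R := fun i k =>
    if h : (k : ℕ) < n then A i ⟨k, h⟩ else lift i k
  have hcol : (P.map φ).col = fun k => b (e.symm k) := by
    funext k i
    show φ (P i k) = _
    by_cases h : (k : ℕ) < n
    · have hk : e.symm k = Sum.inl ⟨k, h⟩ := by
        rw [Equiv.symm_apply_eq, he]; rfl
      simp only [P, dif_pos h, hk]
      rw [basis_sumExtend_inl]
      rfl
    · simp only [P, dif_neg h]
      exact hlift i k
  have hunit : IsUnit (P.map φ) := by
    rw [← Matrix.linearIndependent_cols_iff_isUnit, hcol]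
    exact b.linearIndependent.comp _ e.symm.injective
  have hdet : IsUnit P.det := by
    refine hR.isUnit_of_not_dvd fun h => ?_
    rw [← hφ, RingHom.map_det] at h
    exact ((Matrix.isUnit_iff_isUnit_det _).1 hunit).ne_zero h
  refine ⟨((Matrix.isUnit_iff_isUnit_det P).2 hdet).unit, fun i j => ?_⟩
  rw [IsUnit.unit_spec]
  simp [P]

theorem unit_mul_padRows (hnN : n ≤ N) {A : Matrix (Fin N) (Fin n) R}
    {P : Matrix (Fin N) (Fin N) R} (hP : ∀ i j, P i (Fin.castLE hnN j) = A i j)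
    (X : Matrix (Fin n) (Fin m) R) : P * padRows N X = A * X := by
  ext i c
  rw [Matrix.mul_apply, Matrix.mul_apply]
  symm
  refine Fintype.sum_of_injective (Fin.castLE hnN) (Fin.castLE_injective hnN) _ _ ?_ ?_
  · intro k hk
    have : ¬ (k : ℕ) < n := fun h => hk ⟨⟨k, h⟩, rfl⟩
    rw [padRows, dif_neg this, mul_zero]
  · intro j
    rw [hP, padRows, dif_pos (by simp)]
    rfl

theorem padRows_row_of_lt (X : Matrix (Fin n) (Fin m) R) {i : Fin N} (h : (i : ℕ) < n) :
    padRows N X i = X ⟨i, h⟩ := by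
  funext j
  rw [padRows, dif_pos h]

theorem padRows_row_of_le (X : Matrix (Fin n) (Fin m) R) {i : Fin N} (h : n ≤ (i : ℕ)) :
    padRows N X i = 0 := by
  funext j
  rw [padRows, dif_neg (not_lt.2 h)]; rfl

theorem IsPivot.of_padRows {X : Matrix (Fin n) (Fin m) R} {i : Fin N} {c : Fin m}
    (h : IsPivot π s (padRows N X) i c) : ∃ hi : (i : ℕ) < n, IsPivot π s X ⟨i, hi⟩ c := by
  by_cases hi : (i : ℕ) < n
  · refine ⟨hi, ?_⟩
    unfold IsPivot at h ⊢
    rwa [padRows_row_of_lt X hi] at h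
  · exact absurd (padRows_row_of_le X (not_lt.1 hi)) h.1

theorem IsRowCanonical.padRows {X : Matrix (Fin n) (Fin m) R} (hX : IsRowCanonical π s Res X)
    (N : ℕ) : IsRowCanonical π s Res (padRows N X) where
  zero_below i i' hi hi' := by
    have h : (i : ℕ) < n := by
      by_contra h
      exact hi (padRows_row_of_le X (not_lt.1 h))
    rw [padRows_row_of_lt X h] at hi
    by_cases h' : (i' : ℕ) < n
    · rw [padRows_row_of_lt X h'] at hi'
      exact hX.zero_below _ _ hi hi'
    · exact Fin.lt_def.2 (by omega)
  order_same i i' c c' h h' hd hc := by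
    obtain ⟨hi, h⟩ := h.of_padRows
    obtain ⟨hi', h'⟩ := h'.of_padRows
    rw [padRows_row_of_lt X hi, padRows_row_of_lt X hi'] at hd
    exact hX.order_same _ _ c c' h h' hd hc
  order_diff i i' c c' h h' hd := by
    obtain ⟨hi, h⟩ := h.of_padRows
    obtain ⟨hi', h'⟩ := h'.of_padRows
    rw [padRows_row_of_lt X hi, padRows_row_of_lt X hi'] at hd
    exact hX.order_diff _ _ c c' h h' hd
  pivot_form i c h := by
    obtain ⟨hi, h⟩ := h.of_padRows
    rw [padRows_row_of_lt X hi]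
    exact hX.pivot_form _ c h
  below_pivot i c h i' hlt := by
    obtain ⟨hi, h⟩ := h.of_padRows
    by_cases h' : (i' : ℕ) < n
    · rw [padRows_row_of_lt X h']
      exact hX.below_pivot _ c h _ hlt
    · rw [padRows_row_of_le X (not_lt.1 h')]; rfl
  above_pivot i c h l hl hli i' hlt := by
    obtain ⟨hi, h⟩ := h.of_padRows
    rw [padRows_row_of_lt X hi] at hli
    rw [padRows_row_of_lt X (by rw [Fin.lt_def] at hlt; omega)]
    exact hX.above_pivot _ c h l hl hli _ hlt

/-- With `P` extending `A`, the product `A X` is `P` times the padded `X`, which gives existence;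
uniqueness is `IsRowCanonical.eq_of_unit_mul`. -/
theorem isRCFOf_mul_iff [Finite R] (hR : IsFiniteChainRing R π q s) (hRes : IsResidueSet π Res)
    (hnN : n ≤ N) {X : Matrix (Fin n) (Fin m) R} (hX : IsRowCanonical π s Res X)
    {A : Matrix (Fin N) (Fin n) R} (hA : IsFullColRank π s A) (B : Matrix (Fin N) (Fin m) R) :
    IsRCFOf π s Res B (A * X) ↔ B = padRows N X := by
  obtain ⟨P, hP⟩ := exists_unit_extension hR hnN ((isFullColRank_iff hR.pos A).1 hA)
  have hPX := unit_mul_padRows hnN hP X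
  constructor
  · rintro ⟨hB, U, hU⟩
    replace hU : (U : Matrix (Fin N) (Fin N) R) * (A * X) = B := hU
    refine ((hX.padRows N).eq_of_unit_mul hB hR hRes (U * P) ?_).symm
    rw [Units.val_mul, Matrix.mul_assoc, hPX, hU]
  · rintro rfl
    refine ⟨hX.padRows N, P⁻¹, ?_⟩
    show (↑P⁻¹ : Matrix (Fin N) (Fin N) R) * (A * X) = _
    rw [← hPX, ← Matrix.mul_assoc, Units.inv_mul, Matrix.one_mul]

theorem decode_mul [Finite R] (hR : IsFiniteChainRing R π q s) (hRes : IsResidueSet π Res)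
    (hnN : n ≤ N) {X : Matrix (Fin n) (Fin m) R} (hX : IsRowCanonical π s Res X)
    {A : Matrix (Fin N) (Fin n) R} (hA : IsFullColRank π s A) :
    decode π s Res hnN (A * X) = X := by
  have hiff := isRCFOf_mul_iff hR hRes hnN hX hA
  have h1 : rcf π s Res (A * X) = padRows N X :=
    (hiff _).1 (Classical.epsilon_spec (p := fun B => IsRCFOf π s Res B (A * X))
      ⟨_, (hiff _).2 rfl⟩)
  funext i j
  rw [decode, h1, Matrix.submatrix_apply, padRows_row_of_lt X (by simp)]
  rfl

theorem finite_matrix (R : Type*) [Finite R] (k l : ℕ) : Finite (Matrix (Fin k) (Fin l) R) :=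
  inferInstanceAs (Finite (_ → _ → _))

/-- Ensures that the denominator of the transition probability is nonzero. -/
theorem exists_isFullColRank [Finite R] (hR : IsFiniteChainRing R π q s) (hnN : n ≤ N) :
    ∃ A : Matrix (Fin N) (Fin n) R, IsFullColRank π s A := by
  refine ⟨(1 : Matrix (Fin N) (Fin N) R).submatrix id (Fin.castLE hnN),
    (isFullColRank_iff hR.pos _).2 ?_⟩
  refine Matrix.mulVec_injective_iff.2 ?_
  have h := (Pi.basisFun R (Fin N)).linearIndependent.comp (Fin.castLE hnN)
    (Fin.castLE_injective hnN)
  convert h using 1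
  funext j i
  simp [Matrix.col, Matrix.one_apply, Pi.single_apply]

theorem IsFullColRank.mul_unit [Finite R] (hs : 0 < s) {A : Matrix (Fin N) (Fin n) R}
    (hA : IsFullColRank π s A) (U : (Matrix (Fin n) (Fin n) R)ˣ) :
    IsFullColRank π s (A * (U : Matrix (Fin n) (Fin n) R)) := by
  rw [isFullColRank_iff hs] at hA ⊢
  intro v w hvw
  rw [← Matrix.mulVec_mulVec, ← Matrix.mulVec_mulVec] at hvw
  have h := congrArg (Matrix.mulVec (↑U⁻¹ : Matrix (Fin n) (Fin n) R)) (hA hvw)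
  rwa [Matrix.mulVec_mulVec, Matrix.mulVec_mulVec, Units.inv_mul, Matrix.one_mulVec,
    Matrix.one_mulVec] at h

/-- Right multiplication by `U` permutes the full column rank matrices. Hence the channel sees only
the left equivalence class of its input. -/
theorem mmcProb_unit_mul [Finite R] (hs : 0 < s) (U : (Matrix (Fin n) (Fin n) R)ˣ)
    (X : Matrix (Fin n) (Fin m) R) (Y : Matrix (Fin N) (Fin m) R) :
    mmcProb π s ((U : Matrix (Fin n) (Fin n) R) * X) Y = mmcProb π s X Y := by
  unfold mmcProb
  congr 2
  refine Set.ncard_congr (fun A _ => A * (U : Matrix (Fin n) (Fin n) R)) ?_ ?_ ?_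
  · rintro A ⟨hA, rfl⟩
    exact ⟨hA.mul_unit hs U, Matrix.mul_assoc _ _ _⟩
  · intro A B _ _ h
    have h' := congrArg (fun M => M * (↑U⁻¹ : Matrix (Fin n) (Fin n) R)) h
    simpa only [Matrix.mul_assoc, Units.mul_inv, Matrix.mul_one] using h'
  · rintro B ⟨hB, rfl⟩
    refine ⟨B * (↑U⁻¹ : Matrix (Fin n) (Fin n) R), ⟨hB.mul_unit hs U⁻¹, ?_⟩, ?_⟩
    · rw [Matrix.mul_assoc, ← Matrix.mul_assoc _ _ X, Units.inv_mul, Matrix.one_mul]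
    · rw [Matrix.mul_assoc, Units.inv_mul, Matrix.mul_one]

theorem mmcProb_nonneg (X : Matrix (Fin n) (Fin m) R) (Y : Matrix (Fin N) (Fin m) R) :
    0 ≤ mmcProb π s X Y := by unfold mmcProb; positivity

theorem exists_of_mmcProb_ne_zero {X : Matrix (Fin n) (Fin m) R} {Y : Matrix (Fin N) (Fin m) R}
    (h : mmcProb π s X Y ≠ 0) : ∃ A, IsFullColRank π s A ∧ A * X = Y := by
  by_contra hA
  refine h ?_
  rw [mmcProb, Set.eq_empty_of_forall_notMem (s := {A | IsFullColRank π s A ∧ A * X = Y})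
    fun A hA' => hA ⟨A, hA'⟩]
  simp

variable {μ : Fin s → ℕ}

theorem mul_mem_matSet (M : Matrix (Fin N) (Fin n) R) {X : Matrix (Fin n) (Fin (len μ)) R}
    (hX : X ∈ MatSet π n μ) : M * X ∈ MatSet π N μ := by
  intro i
  rw [Matrix.mul_apply_eq_vecMul, Matrix.vecMul_eq_sum]
  exact Submodule.sum_mem _ fun j _ => Submodule.smul_mem _ _ (hX j)

theorem sum_mmcProb [Finite R] (hR : IsFiniteChainRing R π q s) (hnN : n ≤ N)
    {X : Matrix (Fin n) (Fin (len μ)) R} (hX : X ∈ MatSet π n μ) :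
    ∑ Y : MatSet π N μ, mmcProb π s X Y.1 = 1 := by
  classical
  have := finite_matrix R N n
  have : Fintype (Matrix (Fin N) (Fin n) R) := Fintype.ofFinite _
  let S : Finset (Matrix (Fin N) (Fin n) R) := Finset.univ.filter (IsFullColRank π s)
  let f : Matrix (Fin N) (Fin n) R → MatSet π N μ := fun A => ⟨A * X, mul_mem_matSet A hX⟩
  have h1 : ({A : Matrix (Fin N) (Fin n) R | IsFullColRank π s A}).ncard = S.card := by
    rw [← Set.ncard_coe_finset]; congr 1; ext A; simp [S]
  have h2 : ∀ Y : MatSet π N μ,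
      ({A : Matrix (Fin N) (Fin n) R | IsFullColRank π s A ∧ A * X = Y.1}).ncard =
        (S.filter fun A => f A = Y).card := fun Y => by
    rw [← Set.ncard_coe_finset]; congr 1; ext A; simp [S, f, Subtype.ext_iff]
  have hS : (S.card : ℝ) ≠ 0 := by
    obtain ⟨A, hA⟩ := exists_isFullColRank hR hnN
    exact_mod_cast (Finset.card_pos.2 ⟨A, by simpa [S] using hA⟩).ne'
  unfold mmcProb
  simp_rw [h1, h2]
  rw [← Finset.sum_div, div_eq_one_iff_eq hS]
  exact_mod_cast (Finset.card_eq_sum_card_fiberwise (f := f) (s := S) (t := Finset.univ)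
    fun _ _ => Finset.mem_coe.2 (Finset.mem_univ _)).symm

theorem errorProb_eq_zero [Finite R] (hR : IsFiniteChainRing R π q s) (hRes : IsResidueSet π Res)
    (hnN : n ≤ N) {X : Matrix (Fin n) (Fin (len μ)) R} (hX : IsRowCanonical π s Res X) :
    errorProb π Res hnN μ X = 0 := by
  refine Finset.sum_eq_zero fun Y _ => ?_
  split_ifs with h
  · rfl
  · by_contra h0
    obtain ⟨A, hA, hAY⟩ := exists_of_mmcProb_ne_zero h0
    exact h (hAY ▸ decode_mul hR hRes hnN hX hA)

end FullRank

/-! ### Two general bounds on capacity -/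

section Information

variable {𝒳 𝒴 : Type*} [Fintype 𝒳] [Fintype 𝒴] {q : ℕ} {W : 𝒳 → 𝒴 → ℝ}

/-- A code with zero error is a lower bound for the capacity. -/
theorem logb_card_le_capacity (hW : ∀ x y, 0 ≤ W x y) {C : Finset 𝒳} (hC : C.Nonempty)
    (hsum : ∀ x ∈ C, ∑ y, W x y = 1) {dec : 𝒴 → 𝒳} (hdec : ∀ x ∈ C, ∀ y, W x y ≠ 0 → dec y = x) :
    Real.logb q C.card ≤ capacity q W := by
  classical
  obtain ⟨x₀, hx₀⟩ := hC
  have : Nonempty 𝒳 := ⟨x₀⟩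
  have hcard : (0 : ℝ) < C.card := by exact_mod_cast Finset.card_pos.2 ⟨x₀, hx₀⟩
  -- The uniform distribution on the code attains the bound.
  let p : 𝒳 → ℝ := fun x => if x ∈ C then (C.card : ℝ)⁻¹ else 0
  have hp : p ∈ stdSimplex ℝ 𝒳 := by
    refine ⟨fun x => ?_, ?_⟩
    · dsimp only [p]
      split_ifs <;> positivity
    · simp only [p, Finset.sum_ite_mem, Finset.univ_inter, Finset.sum_const, nsmul_eq_mul]
      exact mul_inv_cancel₀ hcard.ne'
  have hle := (capacity_isGreatest q W hW).2 ⟨p, hp, rfl⟩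
  refine le_trans (le_of_eq ?_) hle
  -- An output determines its codeword, so one term survives and the likelihood ratio is the
  -- constant `C.card`.
  have hout : ∀ x ∈ C, ∀ y, W x y ≠ 0 → ∑ x', p x' * W x' y = (C.card : ℝ)⁻¹ * W x y := by
    intro x hx y hy
    rw [Finset.sum_eq_single x]
    · simp only [p, if_pos hx]
    · intro x' _ hne
      by_cases hx' : x' ∈ C
      · by_cases h0 : W x' y = 0
        · rw [h0, mul_zero]
        · exact absurd ((hdec x' hx' y h0).symm.trans (hdec x hx y hy)) hne
      · simp only [p, if_neg hx', zero_mul]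
    · simp
  have hterm : ∀ x, ∑ y, p x * W x y * Real.logb q (W x y / ∑ x', p x' * W x' y) =
      p x * Real.logb q C.card := by
    intro x
    by_cases hx : x ∈ C
    · have : ∀ y, p x * W x y * Real.logb q (W x y / ∑ x', p x' * W x' y) =
          p x * Real.logb q C.card * W x y := by
        intro y
        by_cases h0 : W x y = 0
        · simp [h0]
        · rw [hout x hx y h0]
          have : W x y / ((C.card : ℝ)⁻¹ * W x y) = C.card := by field_simp
          rw [this]; ring
      rw [Finset.sum_congr rfl fun y _ => this y, ← Finset.mul_sum, hsum x hx, mul_one]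
    · simp [p, if_neg hx]
  rw [mutualInfo, Finset.sum_congr rfl fun x _ => hterm x, ← Finset.sum_mul, hp.2, one_mul]

/-- If the output distribution only depends on the class `f x` of the input `x`, the capacity is at
most the logarithm of the number of classes. -/
theorem capacity_le_logb_card [Nonempty 𝒳] {S : Type*} [Fintype S] (hq : 1 < q)
    (hW : ∀ x y, 0 ≤ W x y) (hsum : ∀ x, ∑ y, W x y = 1) (f : 𝒳 → S)
    (hf : ∀ x x', f x = f x' → W x = W x') :
    capacity q W ≤ Real.logb q (Fintype.card S) := by
  classical
  have hq' : (1 : ℝ) < q := by exact_mod_cast hq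
  have hlq : 0 < Real.log q := Real.log_pos hq'
  obtain ⟨p, hp, hpc⟩ := (capacity_isGreatest q W hW).1
  rw [← hpc]
  have hS : (0 : ℝ) < Fintype.card S := by
    exact_mod_cast Fintype.card_pos_iff.2 ⟨f (Classical.arbitrary 𝒳)⟩
  set M : ℝ := ((Fintype.card S : ℕ) : ℝ) with hM
  let P : S → ℝ := fun σ => ∑ x ∈ Finset.univ.filter (fun x => f x = σ), p x
  -- The output probability is at least `P (f x) * W x y`, so the ratio is at most `1 / P (f x)`.
  -- Then `log t ≤ t - 1` at `t = 1 / (M * P (f x))` bounds the entropy of the class by `log M`.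
  have hle : ∀ x y, p x * W x y ≠ 0 →
      Real.logb q (W x y / ∑ x', p x' * W x' y) ≤ Real.logb q M +
        (1 / (M * P (f x)) - 1) / Real.log q := by
    intro x y hxy
    have hpx : 0 < p x := lt_of_le_of_ne (hp.1 x) fun h => hxy (by rw [← h, zero_mul])
    have hWx : 0 < W x y := lt_of_le_of_ne (hW x y) fun h => hxy (by rw [← h, mul_zero])
    have hPx : 0 < P (f x) := hpx.trans_le
      (Finset.single_le_sum (f := p) (fun x _ => hp.1 x) (by simp))
    have h1 : P (f x) * W x y ≤ ∑ x', p x' * W x' y := by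
      rw [Finset.sum_mul]
      refine le_trans (le_of_eq (Finset.sum_congr rfl fun x' hx' => ?_))
        (Finset.sum_le_univ_sum_of_nonneg (s := Finset.univ.filter (fun x' => f x' = f x))
          fun x' => mul_nonneg (hp.1 x') (hW x' y))
      rw [hf x' x (Finset.mem_filter.1 hx').2]
    have h2 : 0 < P (f x) * W x y := mul_pos hPx hWx
    have h3 : W x y / ∑ x', p x' * W x' y ≤ M * (1 / (M * P (f x))) := by
      rw [div_le_iff₀ (h2.trans_le h1)]
      have : M * (1 / (M * P (f x))) = 1 / P (f x) := by field_simp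
      rw [this, div_mul_eq_mul_div, one_mul, le_div_iff₀ hPx, mul_comm]
      exact h1
    have h4 : 0 < 1 / (M * P (f x)) := by positivity
    calc Real.logb q (W x y / ∑ x', p x' * W x' y)
        ≤ Real.logb q (M * (1 / (M * P (f x)))) :=
          Real.logb_le_logb_of_le hq' (div_pos hWx (h2.trans_le h1)) h3
      _ = Real.logb q M + Real.log (1 / (M * P (f x))) / Real.log q := by
          rw [Real.logb_mul hS.ne' h4.ne']; rfl
      _ ≤ _ := by
          gcongr
          exact Real.log_le_sub_one_of_pos h4
  have hx : ∀ x, ∑ y, p x * W x y * Real.logb q (W x y / ∑ x', p x' * W x' y) ≤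
      p x * Real.logb q M + (p x / P (f x) / M - p x) / Real.log q := by
    intro x
    rcases (hp.1 x).eq_or_lt with h0 | h0
    · simp [← h0]
    have hPx : 0 < P (f x) := h0.trans_le
      (Finset.single_le_sum (f := p) (fun x _ => hp.1 x) (by simp))
    calc ∑ y, p x * W x y * Real.logb q (W x y / ∑ x', p x' * W x' y)
        ≤ ∑ y, p x * W x y * (Real.logb q M + (1 / (M * P (f x)) - 1) / Real.log q) := by
          refine Finset.sum_le_sum fun y _ => ?_
          by_cases h : p x * W x y = 0
          · rw [h, zero_mul, zero_mul]
          · exact mul_le_mul_of_nonneg_left (hle x y h) (mul_nonneg (hp.1 x) (hW x y))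
      _ = p x * (Real.logb q M + (1 / (M * P (f x)) - 1) / Real.log q) := by
          rw [← Finset.sum_mul, ← Finset.mul_sum, hsum, mul_one]
      _ = _ := by field_simp
  -- Each class contributes `1`, or `0` if its probability is zero.
  have hratio : ∑ x, p x / P (f x) ≤ M := by
    rw [← Finset.sum_fiberwise Finset.univ f]
    calc ∑ σ, ∑ x ∈ Finset.univ.filter (fun x => f x = σ), p x / P (f x)
        ≤ ∑ _σ : S, (1 : ℝ) := by
          refine Finset.sum_le_sum fun σ _ => ?_
          rw [Finset.sum_congr rfl fun x hx => by rw [(Finset.mem_filter.1 hx).2],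
            ← Finset.sum_div]
          exact div_self_le_one _
      _ = M := by simp [hM]
  calc mutualInfo q W p
      ≤ ∑ x, (p x * Real.logb q M + (p x / P (f x) / M - p x) / Real.log q) :=
        Finset.sum_le_sum fun x _ => hx x
    _ = Real.logb q M + ((∑ x, p x / P (f x)) / M - 1) / Real.log q := by
        rw [Finset.sum_add_distrib, ← Finset.sum_mul, hp.2, one_mul, ← Finset.sum_div,
          Finset.sum_sub_distrib, hp.2, ← Finset.sum_div]
    _ ≤ Real.logb q M := by
        have h1 : (∑ x, p x / P (f x)) / M ≤ 1 := (div_le_one hS).2 hratio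
        have h2 : ((∑ x, p x / P (f x)) / M - 1) / Real.log q ≤ 0 :=
          div_nonpos_of_nonpos_of_nonneg (by linarith) hlq.le
        linarith

end Information

/-! ### Row operations -/

section RowEquiv

variable {R : Type*} [CommRing R] {n m : ℕ}

/-- Left equivalence of matrices. -/
def RowEquiv (X Y : Matrix (Fin n) (Fin m) R) : Prop :=
  ∃ U : (Matrix (Fin n) (Fin n) R)ˣ, (U : Matrix (Fin n) (Fin n) R) * X = Y

theorem RowEquiv.refl (X : Matrix (Fin n) (Fin m) R) : RowEquiv X X := ⟨1, by simp⟩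

theorem RowEquiv.trans {X Y Z : Matrix (Fin n) (Fin m) R} (h : RowEquiv X Y) (h' : RowEquiv Y Z) :
    RowEquiv X Z := by
  obtain ⟨U, rfl⟩ := h
  obtain ⟨V, rfl⟩ := h'
  exact ⟨V * U, by rw [Units.val_mul, Matrix.mul_assoc]⟩

theorem rowEquiv_of_isUnit_det {X : Matrix (Fin n) (Fin m) R} {U : Matrix (Fin n) (Fin n) R}
    (hU : IsUnit U.det) : RowEquiv X (U * X) :=
  ⟨((Matrix.isUnit_iff_isUnit_det U).2 hU).unit, rfl⟩

theorem rowEquiv_swap (X : Matrix (Fin n) (Fin m) R) (i j : Fin n) :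
    RowEquiv X (X.submatrix (Equiv.swap i j) id) := by
  have h : ((Equiv.swap i j).toPEquiv.toMatrix : Matrix (Fin n) (Fin n) R) * X =
      X.submatrix (Equiv.swap i j) id := by
    rw [PEquiv.toMatrix_toPEquiv_mul]
  rw [← h]
  refine rowEquiv_of_isUnit_det ?_
  rw [show ((Equiv.swap i j).toPEquiv.toMatrix : Matrix (Fin n) (Fin n) R) =
    Equiv.Perm.permMatrix R (Equiv.swap i j) from rfl, Matrix.det_permutation]
  exact ((Equiv.Perm.sign (Equiv.swap i j)).isUnit.map (Int.castRingHom R))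

/-- Scale the first row by a unit and add multiples of it to the other rows. -/
theorem rowEquiv_cons_below (X : Matrix (Fin (n + 1)) (Fin m) R) (u : Rˣ) (w : Fin n → R) :
    RowEquiv X (Fin.cons ((u : R) • X 0) fun i => w i • X 0 + X i.succ) := by
  let M : Matrix (Fin (n + 1)) (Fin (n + 1)) R :=
    Fin.cons (Fin.cons (u : R) 0) fun i => Fin.cons (w i) (Pi.single i 1)
  have hM : M * X = (Fin.cons ((u : R) • X 0) fun i => w i • X 0 + X i.succ) := by
    funext i c
    rw [Matrix.mul_apply, Fin.sum_univ_succ]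
    refine Fin.cases ?_ (fun i => ?_) i
    · simp [M]
    · simp [M, Pi.single_apply]
  rw [← hM]
  refine rowEquiv_of_isUnit_det ?_
  have h1 : M.submatrix Fin.succ (Fin.succAbove 0) = 1 := by
    ext i j
    rw [Matrix.submatrix_apply, Fin.succAbove_zero, Matrix.one_apply]
    show (Pi.single i 1 : Fin n → R) j = _
    rw [Pi.single_apply]
    exact if_congr eq_comm rfl rfl
  have h0 : ∀ j : Fin n, M 0 j.succ = 0 := fun _ => rfl
  have h00 : M 0 0 = u := rfl
  rw [Matrix.det_succ_row_zero, Fin.sum_univ_succ, h1, h00]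
  simp [h0]

/-- Replace the lower rows by equivalent ones and add multiples of them to the first row. -/
theorem rowEquiv_cons_above (X : Matrix (Fin (n + 1)) (Fin m) R) {Y : Matrix (Fin n) (Fin m) R}
    (hY : RowEquiv (fun i : Fin n => X i.succ) Y) (v : Fin n → R) :
    RowEquiv X (Fin.cons (X 0 + Matrix.vecMul v Y) Y) := by
  obtain ⟨U, hU⟩ := hY
  let M : Matrix (Fin (n + 1)) (Fin (n + 1)) R :=
    Fin.cons (Fin.cons 1 (Matrix.vecMul v (U : Matrix (Fin n) (Fin n) R)))
      fun i => Fin.cons 0 ((U : Matrix (Fin n) (Fin n) R) i)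
  have hM : M * X = (Fin.cons (X 0 + Matrix.vecMul v Y) Y) := by
    funext i c
    rw [Matrix.mul_apply, Fin.sum_univ_succ]
    refine Fin.cases ?_ (fun i => ?_) i
    · have h1 : Matrix.vecMul v Y =
          Matrix.vecMul (Matrix.vecMul v (U : Matrix (Fin n) (Fin n) R)) fun i => X i.succ := by
        rw [← hU]
        exact (Matrix.vecMul_vecMul _ _ _).symm
      show 1 * X 0 c + ∑ k : Fin n, Matrix.vecMul v (U : Matrix (Fin n) (Fin n) R) k * X k.succ c =
        X 0 c + Matrix.vecMul v Y c
      rw [h1, one_mul]; rfl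
    · show 0 * X 0 c + ∑ k : Fin n, (U : Matrix (Fin n) (Fin n) R) i k * X k.succ c = Y i c
      rw [← hU, zero_mul, zero_add]; rfl
  rw [← hM]
  refine rowEquiv_of_isUnit_det ?_
  have h1 : M.submatrix (Fin.succAbove 0) Fin.succ = (U : Matrix (Fin n) (Fin n) R) := by
    rw [Fin.succAbove_zero]; rfl
  have h0 : ∀ j : Fin n, M j.succ 0 = 0 := fun _ => rfl
  have h00 : M 0 0 = 1 := rfl
  rw [Matrix.det_succ_column_zero, Fin.sum_univ_succ, h1, h00]
  simp [h0]

end RowEquiv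

/-! ### Gaussian elimination over a chain ring -/

section Echelon

variable {R : Type*} [CommRing R] {π : R} {q s n m : ℕ} {Res : Set R}

/-- `X` is in echelon form with pivots `π ^ l i` in the columns `c i`, up to the order of pivots of
equal degree and their position among the entries of the row of the same degree. -/
structure IsEchelon (π : R) (s : ℕ) (Res : Set R) (l : Fin n → ℕ) (c : Fin n → Fin m)
    (X : Matrix (Fin n) (Fin m) R) : Prop where
  le : ∀ i, l i ≤ s
  dvd : ∀ i j, π ^ l i ∣ X i j
  pivot : ∀ i, X i (c i) = π ^ l i
  below : ∀ i i', i < i' → l i < s → X i' (c i) = 0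
  above : ∀ i i', i' < i → l i < s → X i' (c i) ∈ residuesPow π Res (l i)

/-- Pivot columns are reduced from the top row down: row `k` vanishes in the earlier pivot columns,
so subtracting a multiple of it leaves them reduced. -/
theorem IsEchelon.exists_reduce {l : Fin n → ℕ} {c : Fin n → Fin m} {Y : Matrix (Fin n) (Fin m) R}
    (hY : IsEchelon π s Res l c Y) (hRes : IsResidueSet π Res) (x : Fin m → R) (k : ℕ) :
    ∃ v : Fin n → R, ∀ i : Fin n, (i : ℕ) < k → l i < s →
      (x + Matrix.vecMul v Y) (c i) ∈ residuesPow π Res (l i) := by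
  induction k with
  | zero => exact ⟨0, fun i hi => by omega⟩
  | succ k ih =>
    obtain ⟨v, hv⟩ := ih
    by_cases hk : k < n
    swap
    · exact ⟨v, fun i _ => hv i (by omega)⟩
    obtain ⟨r, hr, t, ht⟩ := hRes.exists_mem_residuesPow ((x + Matrix.vecMul v Y) (c ⟨k, hk⟩))
      (l ⟨k, hk⟩)
    refine ⟨v - Pi.single ⟨k, hk⟩ t, fun i hi hl => ?_⟩
    have h1 : ∀ b, (x + Matrix.vecMul (v - Pi.single ⟨k, hk⟩ t) Y) b =
        (x + Matrix.vecMul v Y) b - t * Y ⟨k, hk⟩ b := fun b => by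
      rw [Matrix.sub_vecMul, Matrix.single_vecMul]
      simp only [Pi.add_apply, Pi.sub_apply, Pi.smul_apply, Matrix.row, smul_eq_mul]
      ring
    rw [h1]
    rcases Nat.lt_succ_iff_lt_or_eq.1 hi with hi | hi
    · rw [hY.below i ⟨k, hk⟩ hi hl, mul_zero, sub_zero]
      exact hv i hi hl
    · have : i = ⟨k, hk⟩ := Fin.ext hi
      subst this
      rw [hY.pivot]
      convert hr using 1
      linear_combination ht

theorem exists_isEchelon [Finite R] [Nonempty (Fin m)] (hR : IsFiniteChainRing R π q s)
    (hRes : IsResidueSet π Res) : ∀ {n : ℕ} (X : Matrix (Fin n) (Fin m) R),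
    ∃ Y, RowEquiv X Y ∧ ∃ (l : Fin n → ℕ) (c : Fin n → Fin m), IsEchelon π s Res l c Y := by
  intro n
  induction n with
  | zero =>
    exact fun X => ⟨X, RowEquiv.refl X, Fin.elim0, Fin.elim0, fun i => i.elim0, fun i => i.elim0,
      fun i => i.elim0, fun i => i.elim0, fun i => i.elim0⟩
  | succ n ih =>
    intro X
    by_cases hX : X = 0
    · subst hX
      -- For the zero matrix every degree is `s`, since `π ^ s = 0`, and the columns are arbitrary.
      refine ⟨0, RowEquiv.refl _, fun _ => s, fun _ => Classical.arbitrary _, fun _ => le_rfl,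
        fun i j => dvd_zero _, fun i => ?_, fun i i' _ h => absurd h (lt_irrefl _),
        fun i i' _ h => absurd h (lt_irrefl _)⟩
      rw [hR.pow_eq_zero le_rfl]; rfl
    -- An entry of least degree in the whole matrix divides all entries, so it can clear its column.
    obtain ⟨⟨i₀, c₀⟩, -, hmin⟩ := Finset.exists_min_image Finset.univ
      (fun p : Fin (n + 1) × Fin m => deg π s (X p.1 p.2)) ⟨(0, Classical.arbitrary _), by simp⟩
    set d := deg π s (X i₀ c₀) with hd
    have hdvd : ∀ i j, π ^ d ∣ X i j := fun i j =>
      (le_deg_iff deg_le).1 (hmin (i, j) (Finset.mem_univ _))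
    have hds : d < s := by
      refine lt_of_le_of_ne deg_le fun h => hX ?_
      funext i j
      have := hdvd i j
      rwa [h, hR.pow_eq_zero le_rfl, zero_dvd_iff] at this
    obtain ⟨u, hu⟩ := (hR.deg_eq_iff hds).1 hd.symm
    let X₁ := X.submatrix (Equiv.swap 0 i₀) id
    have hX₁ : ∀ i j, π ^ d ∣ X₁ i j := fun i j => hdvd _ _
    have hX₁0 : X₁ 0 c₀ = π ^ d * u := by simp [X₁, ← hu]
    choose w hw using fun i => hX₁ i c₀
    let Z : Matrix (Fin n) (Fin m) R := fun i => (-(w i.succ * ↑u⁻¹)) • X₁ 0 + X₁ i.succ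
    have hZd : ∀ i j, π ^ d ∣ Z i j := fun i j =>
      dvd_add (Dvd.dvd.mul_left (hX₁ _ _) _) (hX₁ _ _)
    have hZc : ∀ i, Z i c₀ = 0 := fun i => by
      simp only [Z, Pi.add_apply, Pi.smul_apply, smul_eq_mul, hX₁0, hw i.succ]
      linear_combination (-(w i.succ * π ^ d)) * u.inv_mul
    obtain ⟨Y, ⟨U, hU⟩, l, c, hY⟩ := ih Z
    have hYd : ∀ i j, π ^ d ∣ Y i j := fun i j => by
      rw [← hU, Matrix.mul_apply]
      exact Finset.dvd_sum fun k _ => Dvd.dvd.mul_left (hZd k j) _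
    have hYc : ∀ i, Y i c₀ = 0 := fun i => by
      rw [← hU, Matrix.mul_apply]
      exact Finset.sum_eq_zero fun k _ => by rw [hZc, mul_zero]
    -- The rows of `Y` vanish in column `c₀` and are divisible by `π ^ d`, so reducing the top row
    -- with them preserves its pivot and divisibility.
    obtain ⟨v, hv⟩ := hY.exists_reduce hRes ((↑u⁻¹ : R) • X₁ 0) n
    refine ⟨Fin.cons ((↑u⁻¹ : R) • X₁ 0 + Matrix.vecMul v Y) Y,
      (rowEquiv_swap X 0 i₀).trans ((rowEquiv_cons_below X₁ u⁻¹
        (fun i => -(w i.succ * ↑u⁻¹))).trans (rowEquiv_cons_above _ ⟨U, hU⟩ v)),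
      Fin.cons d l, Fin.cons c₀ c, ?_, ?_, ?_, ?_, ?_⟩
    · exact Fin.cases hds.le hY.le
    · refine Fin.cases (fun j => ?_) hY.dvd
      refine dvd_add (Dvd.dvd.mul_left (hX₁ _ _) _) ?_
      rw [Matrix.vecMul_eq_sum, Finset.sum_apply]
      exact Finset.dvd_sum fun k _ => Dvd.dvd.mul_left (hYd k j) _
    · refine Fin.cases ?_ hY.pivot
      have h : Matrix.vecMul v Y c₀ = 0 := by
        rw [Matrix.vecMul_eq_sum, Finset.sum_apply]
        exact Finset.sum_eq_zero fun k _ => by rw [Pi.smul_apply, hYc, smul_zero]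
      show (↑u⁻¹ : R) * X₁ 0 c₀ + Matrix.vecMul v Y c₀ = π ^ d
      rw [h, hX₁0]
      linear_combination (π ^ d) * u.inv_mul
    · refine Fin.cases (Fin.cases (fun h => absurd h (lt_irrefl _)) fun i' _ _ => hYc i') fun i => ?_
      exact Fin.cases (fun h => absurd h (not_lt.2 (Fin.zero_le _)))
        fun i' h => hY.below i i' (Fin.succ_lt_succ_iff.1 h)
    · refine Fin.cases (fun i' h => absurd h (not_lt.2 (Fin.zero_le _))) fun i => ?_
      exact Fin.cases (fun _ h => hv i i.2 h)
        fun i' h => hY.above i i' (Fin.succ_lt_succ_iff.1 h)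

end Echelon

/-! ### Counting echelon forms and bounding the capacity -/

section Count

variable {R : Type*} [CommRing R] {π : R} {q s n : ℕ} {Res : Set R} {μ : Fin s → ℕ}

/-- The positions `(t, i, b)` such that the `t`-th digit of the entry `(i, b)` of an echelon form
with pivots `π ^ l i` in the columns `c i` and rows in `R^μ` is free. -/
def freeDigits (μ : Fin s → ℕ) (l : Fin n → ℕ) (c : Fin n → Fin (len μ)) (t : Fin s) :
    Finset (Fin n × Fin (len μ)) :=
  (Finset.univ.filter fun i => l i ≤ t) ×ˢ
    ((Finset.univ.filter fun b : Fin (len μ) => shapeExp μ b ≤ t) \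
      (Finset.univ.filter fun i => l i ≤ t).image c)

theorem mem_freeDigits {l : Fin n → ℕ} {c : Fin n → Fin (len μ)} {t : Fin s} {i : Fin n}
    {b : Fin (len μ)} : (i, b) ∈ freeDigits μ l c t ↔
      l i ≤ t ∧ shapeExp μ b ≤ t ∧ ∀ j, l j ≤ t → c j ≠ b := by
  simp [freeDigits]

/-- The function `k (μ - k)` increases up to `⌊μ / 2⌋` and does not increase afterwards, so on `k ≤
n` it is largest at `min n ⌊μ / 2⌋`. -/
theorem mul_sub_le_kappa {k : ℕ} (hk : k ≤ n) (i : Fin s) :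
    k * (μ i - k) ≤ kappa n μ i * (μ i - kappa n μ i) := by
  unfold kappa
  generalize μ i = a
  rcases le_total k a with hka | hka
  swap
  · rw [Nat.sub_eq_zero_of_le hka, mul_zero]; exact Nat.zero_le _
  obtain ⟨e, rfl⟩ := Nat.exists_eq_add_of_le hka
  obtain ⟨f, hf⟩ : ∃ f, k + e = min n ((k + e) / 2) + f :=
    Nat.exists_eq_add_of_le ((min_le_right _ _).trans (Nat.div_le_self _ _))
  generalize hc : min n ((k + e) / 2) = c at hf ⊢
  have hcf : c ≤ f := by omega
  rw [Nat.add_sub_cancel_left, show k + e - c = f by omega]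
  rcases le_total k c with hkc | hkc
  · obtain ⟨d, rfl⟩ := Nat.exists_eq_add_of_le hkc
    have : e = f + d := by omega
    subst this
    nlinarith
  -- If `k ≤ n` exceeds the minimum, that minimum must be the half and not `n`.
  · obtain rfl | hc2 : k = c ∨ c = (k + e) / 2 := by omega
    · rw [show e = f by omega]
    obtain ⟨d, rfl⟩ := Nat.exists_eq_add_of_le hkc
    have : f = e + d := by omega
    subst this
    rcases Nat.eq_zero_or_pos d with rfl | hd
    · simp
    · have : e ≤ c := by omega
      nlinarith

theorem card_filter_shapeExp_le (hμ : Monotone μ) (t : Fin s) :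
    (Finset.univ.filter fun b : Fin (len μ) => shapeExp μ b ≤ t).card = μ t := by
  have h : (Finset.univ.filter fun b : Fin (len μ) => shapeExp μ b ≤ t) =
      (Finset.univ : Finset (Fin (μ t))).map (Fin.castLEEmb (le_len μ t)) := by
    ext b
    simp only [Finset.mem_filter, Finset.mem_univ, true_and, Finset.mem_map]
    have e1 := lt_shapeExp_iff hμ t b
    constructor
    · intro h
      exact ⟨⟨b, by omega⟩, rfl⟩
    · rintro ⟨a, rfl⟩
      have h1 := a.2
      have h2 : ((Fin.castLEEmb (le_len μ t) a : Fin (len μ)) : ℕ) = a := rfl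
      omega
  rw [h, Finset.card_map, Finset.card_univ, Fintype.card_fin]

variable [Finite R]

theorem IsEchelon.col_injective (hR : IsFiniteChainRing R π q s) {m : ℕ} {l : Fin n → ℕ}
    {c : Fin n → Fin m} {X : Matrix (Fin n) (Fin m) R} (hX : IsEchelon π s Res l c X) {i j : Fin n}
    (hi : l i < s) (hj : l j < s) (hc : c i = c j) : i = j := by
  rcases lt_trichotomy i j with h | h | h
  · have := hX.below i j h hi
    rw [hc, hX.pivot] at this
    exact absurd this (hR.pow_ne_zero hj)
  · exact h
  · have := hX.below j i h hj
    rw [← hc, hX.pivot] at this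
    exact absurd this (hR.pow_ne_zero hi)

/-- The `k` pivots of degree at most `t` lie in distinct columns. These are among the first `μ t`
ones, because membership in `R^μ` limits the column exponent at a pivot by its degree; `k (μ t - k)`
positions remain. -/
theorem IsEchelon.card_freeDigits_le (hR : IsFiniteChainRing R π q s) (hμ : Monotone μ)
    {l : Fin n → ℕ} {c : Fin n → Fin (len μ)} {X : Matrix (Fin n) (Fin (len μ)) R}
    (hX : IsEchelon π s Res l c X) (hXμ : X ∈ MatSet π n μ) (t : Fin s) :
    (freeDigits μ l c t).card ≤ kappa n μ t * (μ t - kappa n μ t) := by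
  have hinj : Set.InjOn c (Finset.univ.filter fun i => l i ≤ (t : ℕ)) := by
    intro i hi j hj hij
    have h1 := (Finset.mem_filter.1 hi).2
    have h2 := (Finset.mem_filter.1 hj).2
    exact hX.col_injective hR (by omega) (by omega) hij
  have hsub : (Finset.univ.filter fun i => l i ≤ (t : ℕ)).image c ⊆
      Finset.univ.filter fun b : Fin (len μ) => shapeExp μ b ≤ t := by
    intro b hb
    obtain ⟨i, hi, rfl⟩ := Finset.mem_image.1 hb
    have h1 := (Finset.mem_filter.1 hi).2
    have h2 := Ideal.mem_span_singleton.1 (hXμ i (c i))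
    rw [hX.pivot] at h2
    refine Finset.mem_filter.2 ⟨Finset.mem_univ _, ?_⟩
    by_contra h
    exact hR.not_pow_dvd_pow (by omega) (by omega) h2
  rw [freeDigits, Finset.card_product, Finset.card_sdiff_of_subset hsub,
    Finset.card_image_of_injOn hinj, card_filter_shapeExp_le hμ]
  exact mul_sub_le_kappa ((Finset.card_le_univ _).trans (by simp)) t

/-- In the pivot column of another row `j` the entry is zero, or has digits only below `l j`, when
that column is not yet excluded. Elsewhere only the divisibility constraints act. Rows with `l j =
s` exclude nothing, as `t < s`. -/
theorem IsEchelon.exists_digits (hR : IsFiniteChainRing R π q s) (hRes : IsResidueSet π Res)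
    {l : Fin n → ℕ} {c : Fin n → Fin (len μ)} {X : Matrix (Fin n) (Fin (len μ)) R}
    (hX : IsEchelon π s Res l c X) (hXμ : X ∈ MatSet π n μ) (i : Fin n) (b : Fin (len μ)) :
    ∃ d : ℕ → R, (∀ t, d t ∈ Res) ∧
      (∀ t : Fin s, d t ≠ 0 → (i, b) ∈ freeDigits μ l c t) ∧
      X i b = (if b = c i then π ^ l i else 0) + ∑ t ∈ Finset.range s, d t * π ^ t := by
  have hzero : X i b = (if b = c i then π ^ l i else 0) → ∃ d : ℕ → R, (∀ t, d t ∈ Res) ∧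
      (∀ t : Fin s, d t ≠ 0 → (i, b) ∈ freeDigits μ l c t) ∧
      X i b = (if b = c i then π ^ l i else 0) + ∑ t ∈ Finset.range s, d t * π ^ t := fun h =>
    ⟨fun _ => 0, fun _ => hRes.zero_mem, fun t h => absurd rfl h, by simp [h]⟩
  by_cases hbi : b = c i
  · exact hzero (by rw [if_pos hbi, hbi, hX.pivot])
  have hdvd : π ^ max (l i) (shapeExp μ b) ∣ X i b := by
    rcases max_choice (l i) (shapeExp μ b) with h | h <;> rw [h]
    exacts [hX.dvd i b, Ideal.mem_span_singleton.1 (hXμ i b)]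
  rw [if_neg hbi] at hzero ⊢
  simp only [zero_add] at hzero ⊢
  by_cases hb : ∃ j, l j < s ∧ c j = b
  · obtain ⟨j, hj, rfl⟩ := hb
    have hij : i ≠ j := fun h => hbi (by rw [h])
    rcases lt_or_gt_of_ne hij with h | h
    · obtain ⟨d, hd, hd0, hsum⟩ := hRes.exists_digits_of_dvd hR
        (max_le (hX.le i) (shapeExp_le μ _)) hj.le (hX.above j i h hj) hdvd
      refine ⟨d, hd, fun t ht => mem_freeDigits.2 ?_, hsum⟩
      have := hd0 t ht
      refine ⟨by omega, by omega, fun k hk hkj => ?_⟩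
      have := hX.col_injective hR (by omega) hj hkj
      subst this
      omega
    · exact hzero (hX.below j i h hj)
  · obtain ⟨d, hd, hd0, hsum⟩ := hRes.exists_digits_of_dvd hR
      (max_le (hX.le i) (shapeExp_le μ _)) le_rfl (hRes.mem_residuesPow_top hR _) hdvd
    refine ⟨d, hd, fun t ht => mem_freeDigits.2 ?_, hsum⟩
    have := hd0 t ht
    exact ⟨by omega, by omega, fun k hk hkb => hb ⟨k, by omega, hkb⟩⟩

theorem ncard_isEchelon_le (hR : IsFiniteChainRing R π q s) (hRes : IsResidueSet π Res)
    (hμ : Monotone μ) (l : Fin n → ℕ) (c : Fin n → Fin (len μ)) :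
    {X | X ∈ MatSet π n μ ∧ IsEchelon π s Res l c X}.ncard ≤
      q ^ ∑ t, kappa n μ t * (μ t - kappa n μ t) := by
  classical
  set E := {X | X ∈ MatSet π n μ ∧ IsEchelon π s Res l c X} with hE
  -- The bound on free positions needs an actual echelon form with these pivot data.
  rcases E.eq_empty_or_nonempty with h0 | ⟨X₀, hX₀⟩
  · rw [h0, Set.ncard_empty]; exact Nat.zero_le _
  let D : Type := (t : Fin s) × freeDigits μ l c t
  have hD : Nat.card D ≤ ∑ t, kappa n μ t * (μ t - kappa n μ t) := by
    rw [Nat.card_eq_fintype_card, Fintype.card_sigma]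
    exact Finset.sum_le_sum fun t _ => by
      rw [Fintype.card_coe]
      exact hX₀.2.card_freeDigits_le hR hμ hX₀.1 t
  let Φ : (D → Res) → Matrix (Fin n) (Fin (len μ)) R := fun u i b =>
    (if b = c i then π ^ l i else 0) +
      ∑ t : Fin s, (if h : (i, b) ∈ freeDigits μ l c t then (u ⟨t, (i, b), h⟩ : R) else 0) * π ^ (t : ℕ)
  have hsub : E ⊆ Set.range Φ := by
    rintro X ⟨hXμ, hX⟩
    choose d hd hd0 hsum using fun i b => hX.exists_digits hR hRes hXμ i b
    refine ⟨fun p => ⟨d p.2.1.1 p.2.1.2 p.1, hd _ _ _⟩, ?_⟩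
    funext i b
    rw [hsum i b, Finset.sum_range]
    refine congrArg₂ (· + ·) rfl (Finset.sum_congr rfl fun t _ => ?_)
    split_ifs with h
    · rfl
    · by_contra hne
      exact h (hd0 i b t fun h0 => hne (by rw [h0]))
  have : Finite (D → Res) := inferInstance
  calc E.ncard ≤ (Set.range Φ).ncard := Set.ncard_le_ncard hsub (Set.finite_range Φ)
    _ ≤ Nat.card (D → Res) := by
      rw [← Set.image_univ, ← Set.ncard_univ]
      exact Set.ncard_image_le Set.finite_univ
    _ = q ^ Nat.card D := by rw [Nat.card_fun, hRes.card hR]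
    _ ≤ _ := Nat.pow_le_pow_right hR.one_lt.le hD

/-- The capacity exceeds the rate of the scheme by at most `n log_q ((s + 1) m)`. -/
theorem mmcCapacity_le (hR : IsFiniteChainRing R π q s) (hRes : IsResidueSet π Res)
    (hμ : Monotone μ) {N : ℕ} (hnN : n ≤ N) (hm : 0 < len μ) :
    mmcCapacity π q N n μ ≤ n * Real.logb q ((s + 1) * len μ) + rate π Res q n μ := by
  classical
  have : Nonempty (Fin (len μ)) := ⟨⟨0, hm⟩⟩
  have : Nonempty (MatSet π n μ) := ⟨⟨0, fun _ => Submodule.zero_mem _⟩⟩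
  have := finite_matrix R n (len μ)
  have : Fintype (Matrix (Fin n) (Fin (len μ)) R) := Fintype.ofFinite _
  let E : ((Fin n → Fin (s + 1)) × (Fin n → Fin (len μ))) →
      Finset (Matrix (Fin n) (Fin (len μ)) R) := fun p =>
    Finset.univ.filter fun X => X ∈ MatSet π n μ ∧ IsEchelon π s Res (fun i => (p.1 i : ℕ)) p.2 X
  let S : Finset (Matrix (Fin n) (Fin (len μ)) R) := Finset.univ.biUnion E
  -- The union runs over `(s + 1) ^ n` degree patterns and `len μ ^ n` column patterns.
  have hcard : S.card ≤ ((s + 1) * len μ) ^ n * q ^ ∑ t, kappa n μ t * (μ t - kappa n μ t) := by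
    refine (Finset.card_biUnion_le_card_mul _ _
      (q ^ ∑ t, kappa n μ t * (μ t - kappa n μ t)) fun p _ => ?_).trans (le_of_eq ?_)
    · refine le_trans (le_of_eq ?_) (ncard_isEchelon_le hR hRes hμ (fun i => (p.1 i : ℕ)) p.2)
      rw [← Set.ncard_coe_finset]
      congr 1
      ext X
      simp [E]
    · congr 1
      simp [mul_pow]
  have hex : ∀ X : MatSet π n μ, ∃ Y : S, RowEquiv X.1 Y.1 := by
    rintro ⟨X, hX⟩
    obtain ⟨Y, ⟨U, hU⟩, l, c, hY⟩ := exists_isEchelon hR hRes X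
    refine ⟨⟨Y, Finset.mem_biUnion.2 ⟨(fun i => ⟨l i, Nat.lt_succ_of_le (hY.le i)⟩, c),
      Finset.mem_univ _, Finset.mem_filter.2 ⟨Finset.mem_univ _, ?_, hY⟩⟩⟩, ⟨U, hU⟩⟩
    rw [← hU]
    exact mul_mem_matSet _ hX
  choose f hf using hex
  have hprob : ∀ (X : MatSet π n μ) (Y : MatSet π N μ),
      mmcProb π s X.1 Y.1 = mmcProb π s (f X).1 Y.1 := fun X Y => by
    obtain ⟨U, hU⟩ := hf X
    rw [← hU, mmcProb_unit_mul hR.pos]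
  have h1 : mmcCapacity π q N n μ ≤ Real.logb q (Fintype.card S) :=
    capacity_le_logb_card hR.one_lt (fun _ _ => mmcProb_nonneg _ _)
      (fun X => sum_mmcProb hR hnN X.2) f fun X X' h => funext fun Y => by
        rw [hprob, hprob X', h]
  have hSpos : 0 < S.card := Finset.card_pos.2 ⟨_, (f (Classical.arbitrary _)).2⟩
  have hq : (1 : ℝ) < q := by exact_mod_cast hR.one_lt
  have hq0 : (q : ℝ) ≠ 0 := by positivity
  have hm' : ((s : ℝ) + 1) * len μ ≠ 0 := by positivity
  refine h1.trans ?_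
  rw [Fintype.card_coe, rate, ncard_principalForms hR hRes hμ, Nat.cast_pow, ← Real.logb_pow,
    ← Real.logb_mul (pow_ne_zero _ hm') (pow_ne_zero _ hq0)]
  refine Real.logb_le_logb_of_le hq (by exact_mod_cast hSpos) ?_
  exact_mod_cast hcard

/-- The capacity is at least the rate of the scheme. -/
theorem rate_le_mmcCapacity (hR : IsFiniteChainRing R π q s) (hRes : IsResidueSet π Res)
    (hμ : Monotone μ) {N : ℕ} (hnN : n ≤ N) :
    rate π Res q n μ ≤ mmcCapacity π q N n μ := by
  classical
  have hmem : ∀ X ∈ principalForms π Res n μ (kappa n μ), X ∈ MatSet π n μ := fun X hX => hX.1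
  let C : Finset (MatSet π n μ) :=
    Finset.univ.filter fun X => X.1 ∈ principalForms π Res n μ (kappa n μ)
  have hC : C.card = (principalForms π Res n μ (kappa n μ)).ncard := by
    rw [← Finset.card_map (Function.Embedding.subtype _), ← Set.ncard_coe_finset]
    congr 1
    ext X
    simp only [Finset.coe_map, Set.mem_image, Finset.mem_coe, C, Finset.mem_filter,
      Finset.mem_univ, true_and, Function.Embedding.subtype_apply]
    exact ⟨by rintro ⟨Y, hY, rfl⟩; exact hY, fun hX => ⟨⟨X, hmem X hX⟩, hX, rfl⟩⟩
  have hCne : C.Nonempty := by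
    rw [← Finset.card_pos, hC, ncard_principalForms hR hRes hμ]
    exact pow_pos (zero_lt_one.trans hR.one_lt) _
  -- An output decoded outside the input set is sent to an arbitrary codeword; this never occurs for
  -- a transmitted codeword.
  let dec : MatSet π N μ → MatSet π n μ := fun Y =>
    if h : decode π s Res hnN Y.1 ∈ MatSet π n μ then ⟨_, h⟩ else hCne.choose
  rw [rate, ← hC]
  refine logb_card_le_capacity (dec := dec) (fun _ _ => mmcProb_nonneg _ _) hCne
    (fun X _ => sum_mmcProb hR hnN X.2) fun X hX Y hXY => ?_
  obtain ⟨A, hA, hAY⟩ := exists_of_mmcProb_ne_zero hXY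
  have h1 : decode π s Res hnN Y.1 = X.1 :=
    hAY ▸ decode_mul hR hRes hnN (Finset.mem_filter.1 hX).2.2.2.1 hA
  have h2 : decode π s Res hnN Y.1 ∈ MatSet π n μ := h1 ▸ X.2
  simp only [dec, dif_pos h2]
  exact Subtype.ext h1

end Count

/-! ### Asymptotics -/

section Asymptotics

variable {s : ℕ}

/-- Rounding down costs at most `1`, which is negligible after division by the packet length. -/
theorem tendsto_kappa_div_len {n : ℕ → ℕ} {μ : ℕ → Fin s → ℕ} {nbar : ℝ} {μbar : Fin s → ℝ}
    (hn : ∀ k, (n k : ℝ) = nbar * (len (μ k) : ℝ))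
    (hμ : ∀ k i, (μ k i : ℝ) = μbar i * (len (μ k) : ℝ))
    (hm : Tendsto (fun k => len (μ k)) atTop atTop) (i : Fin s) :
    Tendsto (fun k => (kappa (n k) (μ k) i : ℝ) / (len (μ k) : ℝ)) atTop
      (𝓝 (min nbar (μbar i / 2))) := by
  have hm' : Tendsto (fun k => (len (μ k) : ℝ)) atTop atTop :=
    tendsto_natCast_atTop_atTop.comp hm
  have hbound : ∀ k, (n k : ℝ) ⊓ (μ k i / 2) - 1 ≤ kappa (n k) (μ k) i ∧
      (kappa (n k) (μ k) i : ℝ) ≤ (n k : ℝ) ⊓ (μ k i / 2) := fun k => by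
    have h1 : ((μ k i / 2 : ℕ) : ℝ) ≤ μ k i / 2 := Nat.cast_div_le
    have h2 : (μ k i : ℝ) / 2 - 1 ≤ ((μ k i / 2 : ℕ) : ℝ) := by
      have : μ k i ≤ 2 * (μ k i / 2) + 1 := by omega
      have : (μ k i : ℝ) ≤ 2 * ((μ k i / 2 : ℕ) : ℝ) + 1 := by exact_mod_cast this
      linarith
    rw [kappa, Nat.cast_min]
    refine ⟨le_min ?_ ?_, le_min (min_le_left _ _) ((min_le_right _ _).trans h1)⟩
    · linarith [min_le_left (n k : ℝ) (μ k i / 2)]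
    · linarith [min_le_right (n k : ℝ) (μ k i / 2)]
  have hlow : Tendsto (fun k => min nbar (μbar i / 2) - 1 / (len (μ k) : ℝ)) atTop
      (𝓝 (min nbar (μbar i / 2))) := by
    simpa using tendsto_const_nhds.sub (hm'.const_div_atTop 1)
  have hscale : ∀ k, (n k : ℝ) ⊓ (μ k i / 2) = min nbar (μbar i / 2) * len (μ k) := fun k => by
    rw [hn, hμ, min_mul_of_nonneg _ _ (Nat.cast_nonneg _)]
    congr 1
    ring
  refine tendsto_of_tendsto_of_tendsto_of_le_of_le' hlow tendsto_const_nhds ?_ ?_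
  all_goals
    filter_upwards [hm'.eventually_gt_atTop 0] with k hk
    have h := hbound k
    rw [hscale] at h
  · rw [le_div_iff₀ hk, sub_mul, one_div_mul_cancel hk.ne']
    exact h.1
  · rw [div_le_iff₀ hk]
    exact h.2

theorem tendsto_logb_mul_div (q : ℕ) {a : ℝ} (ha : 0 < a) {m : ℕ → ℕ} (hm : Tendsto m atTop atTop) :
    Tendsto (fun k => Real.logb q (a * m k) / m k) atTop (𝓝 0) := by
  have h1 : Tendsto (fun k => a * (m k : ℝ)) atTop atTop :=
    (tendsto_natCast_atTop_atTop.comp hm).const_mul_atTop ha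
  -- This is `log x / (a⁻¹ x) → 0` at `x = a m`, where the denominator is `m`.
  have h2 := ((Real.tendsto_pow_log_div_mul_add_atTop a⁻¹ 0 1 (inv_ne_zero ha.ne')).comp h1).div_const
    (Real.log q)
  rw [zero_div] at h2
  refine h2.congr fun k => ?_
  simp only [Function.comp_apply, pow_one, add_zero, Real.logb]
  rw [inv_mul_cancel_left₀ ha.ne', div_right_comm]

variable {R : Type*} [CommRing R] [Finite R] {π : R} {q : ℕ} {Res : Set R}

theorem tendsto_rate (hR : IsFiniteChainRing R π q s) (hRes : IsResidueSet π Res)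
    {n : ℕ → ℕ} {μ : ℕ → Fin s → ℕ} {nbar : ℝ} {μbar κbar : Fin s → ℝ}
    (hmono : ∀ k, Monotone (μ k)) (hn : ∀ k, (n k : ℝ) = nbar * (len (μ k) : ℝ))
    (hμ : ∀ k i, (μ k i : ℝ) = μbar i * (len (μ k) : ℝ))
    (hm : Tendsto (fun k => len (μ k)) atTop atTop)
    (hκ : ∀ i, Tendsto (fun k => (kappa (n k) (μ k) i : ℝ) / (len (μ k) : ℝ)) atTop
      (𝓝 (κbar i))) :
    Tendsto (fun k => rate π Res q (n k) (μ k) / ((n k : ℝ) * ∑ i, (μ k i : ℝ))) atTop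
      (𝓝 ((∑ i, κbar i * (μbar i - κbar i)) / (nbar * ∑ i, μbar i))) := by
  have hlim := (tendsto_finsetSum Finset.univ fun i _ =>
    (hκ i).mul ((tendsto_const_nhds (x := μbar i)).sub (hκ i))).div_const (nbar * ∑ i, μbar i)
  refine hlim.congr' ?_
  filter_upwards [hm.eventually_gt_atTop 0] with k hk
  have hk' : (len (μ k) : ℝ) ≠ 0 := by exact_mod_cast hk.ne'
  have hden : (n k : ℝ) * ∑ i, (μ k i : ℝ) =
      (nbar * ∑ i, μbar i) * ((len (μ k) : ℝ) * len (μ k)) := by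
    simp_rw [hn, hμ, ← Finset.sum_mul]
    ring
  have hnum : rate π Res q (n k) (μ k) = (∑ i, (kappa (n k) (μ k) i : ℝ) / len (μ k) *
      (μbar i - (kappa (n k) (μ k) i : ℝ) / len (μ k))) * ((len (μ k) : ℝ) * len (μ k)) := by
    rw [rate_eq hR hRes (hmono k), Finset.sum_mul]
    refine Finset.sum_congr rfl fun i _ => ?_
    rw [hμ]
    field_simp
  rw [hden, hnum, mul_div_mul_right _ _ (mul_ne_zero hk' hk')]

/-- Squeezed between the rate and the rate plus `n log_q ((s + 1) m)`; the factor `n` cancels in the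
normalized error. -/
theorem tendsto_mmcCapacity (hR : IsFiniteChainRing R π q s) (hRes : IsResidueSet π Res)
    {n N : ℕ → ℕ} {μ : ℕ → Fin s → ℕ} {nbar : ℝ} {μbar : Fin s → ℝ} {C : ℝ}
    (hnN : ∀ k, n k ≤ N k) (hmono : ∀ k, Monotone (μ k)) (hnbar : 0 < nbar)
    (hn : ∀ k, (n k : ℝ) = nbar * (len (μ k) : ℝ))
    (hμ : ∀ k i, (μ k i : ℝ) = μbar i * (len (μ k) : ℝ))
    (hm : Tendsto (fun k => len (μ k)) atTop atTop)
    (hrate : Tendsto (fun k => rate π Res q (n k) (μ k) / ((n k : ℝ) * ∑ i, (μ k i : ℝ))) atTop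
      (𝓝 C)) :
    Tendsto (fun k => mmcCapacity π q (N k) (n k) (μ k) / ((n k : ℝ) * ∑ i, (μ k i : ℝ))) atTop
      (𝓝 C) := by
  have herr : Tendsto (fun k => Real.logb q ((s + 1) * len (μ k)) / len (μ k) / ∑ i, μbar i) atTop
      (𝓝 0) := by
    simpa using (tendsto_logb_mul_div q (a := (s : ℝ) + 1) (by positivity) hm).div_const
      (∑ i, μbar i)
  have hup := herr.add hrate
  rw [zero_add] at hup
  refine tendsto_of_tendsto_of_tendsto_of_le_of_le' hrate hup ?_ ?_
  · exact Eventually.of_forall fun k => div_le_div_of_nonneg_right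
      (rate_le_mmcCapacity hR hRes (hmono k) (hnN k)) (by positivity)
  · filter_upwards [hm.eventually_gt_atTop 0] with k hk
    have hk' : (len (μ k) : ℝ) ≠ 0 := by exact_mod_cast hk.ne'
    have hn0 : (n k : ℝ) ≠ 0 := by rw [hn]; exact mul_ne_zero hnbar.ne' hk'
    have h1 : Real.logb q ((s + 1) * len (μ k)) / len (μ k) / ∑ i, μbar i =
        n k * Real.logb q ((s + 1) * len (μ k)) / ((n k : ℝ) * ∑ i, (μ k i : ℝ)) := by
      simp_rw [hμ, ← Finset.sum_mul]
      rw [mul_div_mul_left _ _ hn0, div_div, mul_comm (len (μ k) : ℝ)]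
    rw [h1, ← add_div]
    exact div_le_div_of_nonneg_right (mmcCapacity_le hR hRes (hmono k) (hnN k) hk) (by positivity)

end Asymptotics

end MMC

end

theorem mainTheorem8 {R : Type*} [CommRing R] [Finite R] (π : R) (q s : ℕ)
    (hR : MMC.IsFiniteChainRing R π q s) (Res : Set R) (hRes : MMC.IsResidueSet π Res) :
    -- the scheme is well defined, has the claimed rate and is error-free
    (∀ (n N : ℕ) (hnN : n ≤ N) (μ : Fin s → ℕ), Monotone μ →
      Nat.card Res = q ∧
      Nat.card (MMC.MsgIdx μ (MMC.kappa n μ)) =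
        ∑ i, MMC.kappa n μ i * (μ i - MMC.kappa n μ i) ∧
      Set.BijOn (MMC.encode (Res := Res) π n μ (MMC.kappa n μ)) Set.univ
        (MMC.principalForms π Res n μ (MMC.kappa n μ)) ∧
      MMC.rate π Res q n μ =
        ∑ i, (MMC.kappa n μ i : ℝ) * ((μ i : ℝ) - (MMC.kappa n μ i : ℝ)) ∧
      ∀ X ∈ MMC.principalForms π Res n μ (MMC.kappa n μ),
        (∀ A : Matrix (Fin N) (Fin n) R, MMC.IsFullColRank π s A →
          (∀ B, MMC.IsRCFOf π s Res B (A * X) ↔ B = MMC.padRows N X) ∧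
          MMC.decode π s Res hnN (A * X) = X) ∧
        (∑ Y : MMC.MatSet π N μ, MMC.mmcProb π s X Y.1) = 1 ∧
        MMC.errorProb π Res hnN μ X = 0) ∧
    -- it achieves the asymptotic capacity
    (∀ (n N : ℕ → ℕ) (μ : ℕ → Fin s → ℕ) (nbar : ℝ) (μbar κbar : Fin s → ℝ),
      (∀ k, n k ≤ N k) → (∀ k, Monotone (μ k)) → 0 < nbar →
      (∀ k, (n k : ℝ) = nbar * (MMC.len (μ k) : ℝ)) →
      (∀ k i, (μ k i : ℝ) = μbar i * (MMC.len (μ k) : ℝ)) →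
      Tendsto (fun k => MMC.len (μ k)) atTop atTop →
      (∀ i, κbar i = min nbar (μbar i / 2)) →
      (∀ i, Tendsto (fun k => (MMC.kappa (n k) (μ k) i : ℝ) / (MMC.len (μ k) : ℝ)) atTop
          (𝓝 (κbar i))) ∧
        Tendsto (fun k => MMC.mmcCapacity π q (N k) (n k) (μ k) /
            ((n k : ℝ) * ∑ i, (μ k i : ℝ))) atTop
          (𝓝 ((∑ i, κbar i * (μbar i - κbar i)) / (nbar * ∑ i, μbar i))) ∧
        Tendsto (fun k => MMC.rate π Res q (n k) (μ k) /
            ((n k : ℝ) * ∑ i, (μ k i : ℝ))) atTop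
          (𝓝 ((∑ i, κbar i * (μbar i - κbar i)) / (nbar * ∑ i, μbar i)))) := by
  refine ⟨fun n N hnN μ hμ => ⟨hRes.card hR, MMC.card_msgIdx _ _,
    MMC.bijOn_encode hR hRes hμ (MMC.kappa_mono n hμ) (MMC.kappa_le n μ) (MMC.kappa_le_left n μ),
    MMC.rate_eq hR hRes hμ n, fun X hX => ⟨fun A hA =>
      ⟨MMC.isRCFOf_mul_iff hR hRes hnN hX.2.2.1 hA, MMC.decode_mul hR hRes hnN hX.2.2.1 hA⟩,
      MMC.sum_mmcProb hR hnN hX.1, MMC.errorProb_eq_zero hR hRes hnN hX.2.2.1⟩⟩, ?_⟩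
  intro n N μ nbar μbar κbar hnN hmono hnbar hn hμ hm hκbar
  have hκ : ∀ i, Tendsto (fun k => (MMC.kappa (n k) (μ k) i : ℝ) / (MMC.len (μ k) : ℝ)) atTop
      (𝓝 (κbar i)) := fun i => by
    rw [hκbar i]
    exact MMC.tendsto_kappa_div_len hn hμ hm i
  have hrate := MMC.tendsto_rate hR hRes hmono hn hμ hm hκ
  exact ⟨hκ, MMC.tendsto_mmcCapacity hR hRes hnN hmono hnbar hn hμ hm hrate, hrate⟩
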